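/- Let $N\ge 1$, $R>0$, and let $B_R\subset\mathbb R^N$ be the open ball of radius $R$ centred at the origin. Let $f\colon[0,R]\times\mathbb R\times[0,+\infty[\,\to\,]-\infty,+\infty]$ be a normal integrand, i.e. $f(r,\cdot,\cdot)$ is lower semicontinuous for almost every $r\in[0,R]$ and there is a Borel function $\hat f\colon[0,R]\times\mathbb R\times[0,+\infty[\,\to\,]-\infty,+\infty]$ with $\hat f(r,\cdot,\cdot)=f(r,\cdot,\cdot)$ for almost every $r\in[0,R]$. Assume that for almost every $(r,t)\in[0,R]\times\mathbb R$ the map $s\mapsto f(r,t,s)$ is non-decreasing. For $u\in W^{1,1}_0(B_R)$ put $$F(u)=\int_{B_R} f(|x|,u(x),|\nabla u(x)|)\,dx\in[-\infty,+\infty],$$ where the integral is understood as $+\infty$ if the positive part of the integrand is not integrable. A minimizer of $F$ is a function $u\in W^{1,1}_0(B_R)$ with $F(u)$ finite and $F(u)\le F(w)$ for all $w\in W^{1,1}_0(B_R)$. A function is called radially symmetric if it coincides almost everywhere on $B_R$ with a function of $|x|$. Then: 1. For every $u\in W^{1,1}_0(B_R)$ with $F(u)>-\infty$ there exists a radially symmetric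 $v\in W^{1,1}_0(B_R)$ such that $F(v)\le F(u)$. 2. If $F$ admits a minimizer in $W^{1,1}_0(B_R)$, then it admits a radially symmetric minimizer. 3. If $N\ge 2$ and, in addition, for almost every $(r,t)\in[0,R]\times\mathbb R$ the map $s\mapsto f(r,t,s)$ is strictly increasing, then every minimizer of $F$ in $W^{1,1}_0(B_R)$ is radially symmetric. -/

import Mathlib

open MeasureTheory Filter Topology Set
open scoped NNReal ENNReal ContDiff

noncomputable section

/-- `φ` is a test function on `Ω`: smooth, with compact support contained in `Ω`. -/
def IsTestFunction {N : ℕ} (Ω : Set (EuclideanSpace ℝ (Fin N)))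
    (φ : EuclideanSpace ℝ (Fin N) → ℝ) : Prop :=
  ContDiff ℝ ∞ φ ∧ HasCompactSupport φ ∧ tsupport φ ⊆ Ω

/-- `G` is a weak (distributional) gradient of `u` on `Ω`. -/
def HasWeakGradient {N : ℕ} (Ω : Set (EuclideanSpace ℝ (Fin N)))
    (u : EuclideanSpace ℝ (Fin N) → ℝ)
    (G : EuclideanSpace ℝ (Fin N) → EuclideanSpace ℝ (Fin N)) : Prop :=
  LocallyIntegrableOn u Ω ∧ LocallyIntegrableOn G Ω ∧
    ∀ φ : EuclideanSpace ℝ (Fin N) → ℝ, IsTestFunction Ω φ →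
      ∀ i : Fin N,
        ∫ x in Ω, u x * fderiv ℝ φ x (EuclideanSpace.single i 1) = -∫ x in Ω, G x i * φ x

open Classical in
/-- A representative of the weak gradient of `u` on `Ω` (which is unique up to null sets when `Ω`
is open), and `0` if `u` has no weak gradient. -/
def weakGradient {N : ℕ} (Ω : Set (EuclideanSpace ℝ (Fin N)))
    (u : EuclideanSpace ℝ (Fin N) → ℝ) : EuclideanSpace ℝ (Fin N) → EuclideanSpace ℝ (Fin N) :=
  if h : ∃ G, HasWeakGradient Ω u G then h.choose else 0

/-- Membership in the Sobolev space `W^{1,1}(Ω)`. -/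
def MemW11 {N : ℕ} (Ω : Set (EuclideanSpace ℝ (Fin N)))
    (u : EuclideanSpace ℝ (Fin N) → ℝ) : Prop :=
  IntegrableOn u Ω ∧ HasWeakGradient Ω u (weakGradient Ω u) ∧ IntegrableOn (weakGradient Ω u) Ω

/-- Membership in `W^{1,1}_0(Ω)`, the closure of the test functions on `Ω` in `W^{1,1}(Ω)`. -/
def MemW11Zero {N : ℕ} (Ω : Set (EuclideanSpace ℝ (Fin N)))
    (u : EuclideanSpace ℝ (Fin N) → ℝ) : Prop :=
  MemW11 Ω u ∧
    ∃ φ : ℕ → EuclideanSpace ℝ (Fin N) → ℝ, (∀ n, IsTestFunction Ω (φ n)) ∧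
      Tendsto (fun n => (∫⁻ x in Ω, ‖φ n x - u x‖ₑ) +
        ∫⁻ x in Ω, ‖gradient (φ n) x - weakGradient Ω u x‖ₑ) atTop (𝓝 0)

/-- `f : [0,R] × ℝ × [0,+∞[ → ]-∞,+∞]` is a normal integrand. Only the values of `f r` for
`r ∈ [0,R]` are relevant. -/
def IsNormalIntegrand (R : ℝ) (f : ℝ → ℝ → ℝ≥0 → EReal) : Prop :=
  (∀ r ∈ Icc 0 R, ∀ t s, f r t s ≠ ⊥) ∧
  (∀ᵐ r ∂volume.restrict (Icc 0 R), LowerSemicontinuous fun p : ℝ × ℝ≥0 => f r p.1 p.2) ∧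
  ∃ g : ℝ → ℝ → ℝ≥0 → EReal,
    (∀ r t s, g r t s ≠ ⊥) ∧
    (Measurable fun p : ℝ × ℝ × ℝ≥0 => g p.1 p.2.1 p.2.2) ∧
    ∀ᵐ r ∂volume.restrict (Icc 0 R), g r = f r

open Classical in
/-- The integral of an extended-real-valued function, in `[-∞,+∞]`: the integral of the positive
part minus that of the negative part, and `+∞` whenever the integral of the positive part is
`+∞`. -/
def erealIntegral {α : Type*} [MeasurableSpace α] (μ : Measure α) (h : α → EReal) : EReal :=
  if ∫⁻ x, (h x).toENNReal ∂μ = ⊤ then ⊤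
  else ((∫⁻ x, (h x).toENNReal ∂μ : ℝ≥0∞) : EReal) - ((∫⁻ x, (-h x).toENNReal ∂μ : ℝ≥0∞) : EReal)

/-- The functional `F(u) = ∫_{B_R} f(|x|, u(x), |∇u(x)|) dx`, where `B_R` is the open ball of
radius `R` centred at the origin of `ℝ^N`. -/
def energy {N : ℕ} (R : ℝ) (f : ℝ → ℝ → ℝ≥0 → EReal) (u : EuclideanSpace ℝ (Fin N) → ℝ) : EReal :=
  erealIntegral (volume.restrict (Metric.ball (0 : EuclideanSpace ℝ (Fin N)) R))
    fun x => f ‖x‖ (u x) ‖weakGradient (Metric.ball 0 R) u x‖₊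

/-- `u` is a minimizer of the energy in `W^{1,1}_0(B_R)`; as usual, the minimum is finite. -/
def IsEnergyMinimizer {N : ℕ} (R : ℝ) (f : ℝ → ℝ → ℝ≥0 → EReal)
    (u : EuclideanSpace ℝ (Fin N) → ℝ) : Prop :=
  MemW11Zero (Metric.ball 0 R) u ∧ energy R f u ≠ ⊥ ∧ energy R f u ≠ ⊤ ∧
    ∀ w : EuclideanSpace ℝ (Fin N) → ℝ, MemW11Zero (Metric.ball 0 R) w → energy R f u ≤ energy R f w

/-- `u` is (almost everywhere equal to) a radially symmetric function on `B_R`. -/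
def IsRadiallySymmetric {N : ℕ} (R : ℝ) (u : EuclideanSpace ℝ (Fin N) → ℝ) : Prop :=
  ∃ w : ℝ → ℝ, ∀ᵐ x ∂volume.restrict (Metric.ball (0 : EuclideanSpace ℝ (Fin N)) R), u x = w ‖x‖

end

/-!
For a unit vector `e` let `v_e(x) = u(‖x‖ e)` be the radial function which takes on every sphere the
value of `u` in the direction `e`. Its gradient has length `|∂_r u|` at the point `‖x‖ e`, where
`∂_r u` is the radial derivative of `u`. By integration in polar coordinates, the mean over `e` of
the energies of `v_e` is the integral of `f(‖x‖, u, |∂_r u|)`, which is at most the energy of `u`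
since `|∂_r u| ≤ |∇u|` and `f` is non-decreasing in its last variable. So some `v_e` has at most the
energy of `u` (`exists_erealIntegral_ray_le`). If `u` is a minimizer then no `v_e` does better, which
forces `f(‖x‖, u, |∂_r u|) = f(‖x‖, u, |∇u|)` almost everywhere (`ae_eq_of_erealIntegral_le_ray`);
for strictly increasing `f` the gradient of `u` is then radial, and `u` is radially symmetric.

Sobolev functions are handled through approximation by test functions in `W^{1,1}`
(`IsStrongLimit`), which determines the weak gradient. By Fatou's lemma the approximation passes to
almost every slice of a measure preserving parametrization (`IsStrongLimit.ae_slice`). For the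
parametrization by polar coordinates this shows that `v_e` belongs to `W^{1,1}_0` for almost every `e`
(`IsStrongLimit.ae_rayExtension`); the kink of `v_e` at the origin is removed by replacing `‖x‖` with
`√(δ² + ‖x‖²)`.

The monotonicity of `f(r, t, ·)` may fail for `(r, t)` in a null set `Z` of the plane, which the points
`(‖x‖, u x)` may well hit on a set of positive measure. On that set, however, `∇u` is radial, so
that `|∂_r u| = |∇u|` there anyway (`IsStrongLimit.ae_radial_of_mem_null`): along almost every circle
obtained by letting a point rotate in a coordinate plane, `‖x‖` is constant and `u` is absolutely
continuous, and the derivative of an absolutely continuous function vanishes almost everywhere on the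
preimage of a null set.

Finally, a function whose gradient is radial is invariant under every plane rotation up to a null set
depending on the rotation. Its averages over balls are invariant at every point, hence functions of
the norm, and they converge almost everywhere to the function
(`IsStrongLimit.isRadiallySymmetric`).
-/

/-! ### Strong limits of test functions -/

/-- The pair `(u, G)` is a limit in `W^{1,1}(Ω)` of pairs `(φ, ∇φ)` with `φ` a test function on
`Ω`. Unlike `MemW11Zero`, the gradient `G` is carried along explicitly, so that both members of the
pair may be changed on null sets. -/
structure IsStrongLimit {N : ℕ} (Ω : Set (EuclideanSpace ℝ (Fin N)))
    (u : EuclideanSpace ℝ (Fin N) → ℝ)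
    (G : EuclideanSpace ℝ (Fin N) → EuclideanSpace ℝ (Fin N)) : Prop where
  integrableOn : IntegrableOn u Ω
  integrableOn_grad : IntegrableOn G Ω
  approx : ∀ ε : ℝ≥0∞, ε ≠ 0 → ∃ φ : EuclideanSpace ℝ (Fin N) → ℝ, IsTestFunction Ω φ ∧
    (∫⁻ x in Ω, ‖φ x - u x‖ₑ) + ∫⁻ x in Ω, ‖gradient φ x - G x‖ₑ ≤ ε

section StrongLimit

variable {N : ℕ} {Ω : Set (EuclideanSpace ℝ (Fin N))}

lemma inner_gradient_eq_fderiv {φ : EuclideanSpace ℝ (Fin N) → ℝ}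
    (x v : EuclideanSpace ℝ (Fin N)) : inner ℝ (gradient φ x) v = fderiv ℝ φ x v := by
  simp [gradient]

lemma gradient_apply (φ : EuclideanSpace ℝ (Fin N) → ℝ) (x : EuclideanSpace ℝ (Fin N))
    (i : Fin N) : gradient φ x i = fderiv ℝ φ x (EuclideanSpace.single i 1) := by
  rw [← inner_gradient_eq_fderiv, real_inner_comm, EuclideanSpace.inner_single_left]
  simp

namespace IsTestFunction

variable {φ : EuclideanSpace ℝ (Fin N) → ℝ}

lemma continuous (hφ : IsTestFunction Ω φ) : Continuous φ := hφ.1.continuous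

lemma differentiable (hφ : IsTestFunction Ω φ) : Differentiable ℝ φ :=
  hφ.1.differentiable (by simp)

lemma continuous_fderiv (hφ : IsTestFunction Ω φ) : Continuous (fderiv ℝ φ) :=
  hφ.1.continuous_fderiv (by simp)

lemma continuous_gradient (hφ : IsTestFunction Ω φ) : Continuous (gradient φ) :=
  (InnerProductSpace.toDual ℝ _).symm.continuous.comp hφ.continuous_fderiv

lemma hasCompactSupport_gradient (hφ : IsTestFunction Ω φ) : HasCompactSupport (gradient φ) :=
  (hφ.2.1.fderiv ℝ).comp_left (g := (InnerProductSpace.toDual ℝ _).symm) (by simp)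

lemma integrable (hφ : IsTestFunction Ω φ) : Integrable φ :=
  hφ.continuous.integrable_of_hasCompactSupport hφ.2.1

lemma integrable_gradient (hφ : IsTestFunction Ω φ) : Integrable (gradient φ) :=
  hφ.continuous_gradient.integrable_of_hasCompactSupport hφ.hasCompactSupport_gradient

lemma exists_bound (hφ : IsTestFunction Ω φ) :
    ∃ C : ℝ≥0, (∀ x, ‖φ x‖ ≤ C) ∧ ∀ x, ‖gradient φ x‖ ≤ C := by
  obtain ⟨C₁, h₁⟩ := hφ.2.1.exists_bound_of_continuous hφ.continuous
  obtain ⟨C₂, h₂⟩ := hφ.hasCompactSupport_gradient.exists_bound_of_continuous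
    hφ.continuous_gradient
  exact ⟨(max C₁ C₂).toNNReal, fun x => (h₁ x).trans ((le_max_left _ _).trans (le_max_left _ _)),
    fun x => (h₂ x).trans ((le_max_right _ _).trans (le_max_left _ _))⟩

lemma eq_zero_of_notMem (hφ : IsTestFunction Ω φ) {x : EuclideanSpace ℝ (Fin N)} (hx : x ∉ Ω) :
    φ x = 0 :=
  image_eq_zero_of_notMem_tsupport fun h => hx (hφ.2.2 h)

lemma zero : IsTestFunction Ω (0 : EuclideanSpace ℝ (Fin N) → ℝ) :=
  ⟨contDiff_const, HasCompactSupport.zero, by simp [tsupport]⟩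

/-- Integration by parts for two test functions. -/
lemma setIntegral_mul_fderiv (hφ : IsTestFunction Ω φ) {ψ : EuclideanSpace ℝ (Fin N) → ℝ}
    (hψ : IsTestFunction Ω ψ) (i : Fin N) :
    ∫ x in Ω, φ x * fderiv ℝ ψ x (EuclideanSpace.single i 1) = -∫ x in Ω, gradient φ x i * ψ x := by
  have c1 : Continuous fun x => fderiv ℝ ψ x (EuclideanSpace.single i 1) :=
    hψ.continuous_fderiv.clm_apply continuous_const
  have c2 : Continuous fun x => fderiv ℝ φ x (EuclideanSpace.single i 1) :=
    hφ.continuous_fderiv.clm_apply continuous_const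
  rw [setIntegral_eq_integral_of_forall_compl_eq_zero
      (fun x hx => by rw [hφ.eq_zero_of_notMem hx, zero_mul]),
    setIntegral_eq_integral_of_forall_compl_eq_zero
      (fun x hx => by rw [hψ.eq_zero_of_notMem hx, mul_zero])]
  simp_rw [gradient_apply]
  refine integral_mul_fderiv_eq_neg_fderiv_mul_of_integrable ?_ ?_ ?_
    (fun x _ => hφ.differentiable x) (fun x _ => hψ.differentiable x)
  · exact (c2.mul hψ.continuous).integrable_of_hasCompactSupport hψ.2.1.mul_left
  · exact (hφ.continuous.mul c1).integrable_of_hasCompactSupport hφ.2.1.mul_right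
  · exact (hφ.continuous.mul hψ.continuous).integrable_of_hasCompactSupport hφ.2.1.mul_right

end IsTestFunction

lemma MeasureTheory.IntegrableOn.euclidean_apply
    {G : EuclideanSpace ℝ (Fin N) → EuclideanSpace ℝ (Fin N)}
    (hG : IntegrableOn G Ω) (i : Fin N) : IntegrableOn (fun x => G x i) Ω :=
  (EuclideanSpace.proj (𝕜 := ℝ) i).integrable_comp hG

lemma IsStrongLimit.hasWeakGradient {u : EuclideanSpace ℝ (Fin N) → ℝ}
    {G : EuclideanSpace ℝ (Fin N) → EuclideanSpace ℝ (Fin N)} (h : IsStrongLimit Ω u G) :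
    HasWeakGradient Ω u G := by
  refine ⟨h.integrableOn.locallyIntegrableOn, h.integrableOn_grad.locallyIntegrableOn,
    fun ψ hψ i => ?_⟩
  obtain ⟨C, hC, hC'⟩ := hψ.exists_bound
  have hd : ∀ x, ‖fderiv ℝ ψ x (EuclideanSpace.single i 1)‖ ≤ C := fun x => by
    rw [← gradient_apply]
    exact (PiLp.norm_apply_le _ i).trans (hC' x)
  have c1 : Continuous fun x => fderiv ℝ ψ x (EuclideanSpace.single i 1) :=
    hψ.continuous_fderiv.clm_apply continuous_const
  have iu : ∀ {v : EuclideanSpace ℝ (Fin N) → ℝ}, IntegrableOn v Ω →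
      IntegrableOn (fun x => v x * fderiv ℝ ψ x (EuclideanSpace.single i 1)) Ω := fun hv =>
    Integrable.mul_bdd (c := C) hv c1.aestronglyMeasurable (ae_of_all _ hd)
  have iG : ∀ {v : EuclideanSpace ℝ (Fin N) → ℝ}, IntegrableOn v Ω →
      IntegrableOn (fun x => v x * ψ x) Ω := fun hv =>
    Integrable.mul_bdd (c := C) hv hψ.continuous.aestronglyMeasurable (ae_of_all _ hC)
  have hGi := h.integrableOn_grad.euclidean_apply i
  suffices H : ∀ ε : ℝ≥0∞, ε ≠ 0 →
      ‖(∫ x in Ω, u x * fderiv ℝ ψ x (EuclideanSpace.single i 1)) + ∫ x in Ω, G x i * ψ x‖ₑ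
        ≤ C * ε by
    have h0 : ‖(∫ x in Ω, u x * fderiv ℝ ψ x (EuclideanSpace.single i 1))
        + ∫ x in Ω, G x i * ψ x‖ₑ = 0 := by
      have hlim : Tendsto (fun n : ℕ => (C : ℝ≥0∞) * (n : ℝ≥0∞)⁻¹) atTop (𝓝 (C * 0)) :=
        ENNReal.Tendsto.const_mul ENNReal.tendsto_inv_nat_nhds_zero (.inr ENNReal.coe_ne_top)
      rw [mul_zero] at hlim
      exact le_antisymm (ge_of_tendsto' hlim fun n => H _ (by simp)) zero_le
    linarith [enorm_eq_zero.1 h0]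
  intro ε hε
  obtain ⟨φ, hφ, hle⟩ := h.approx ε hε
  have hφi := (hφ.integrable_gradient.integrableOn (s := Ω)).euclidean_apply i
  have hφ' := hφ.integrable.integrableOn (s := Ω)
  have key : (∫ x in Ω, u x * fderiv ℝ ψ x (EuclideanSpace.single i 1)) + ∫ x in Ω, G x i * ψ x
      = -((∫ x in Ω, (φ x - u x) * fderiv ℝ ψ x (EuclideanSpace.single i 1)) +
        ∫ x in Ω, (gradient φ x i - G x i) * ψ x) := by
    simp_rw [sub_mul]
    rw [integral_sub (iu hφ') (iu h.integrableOn), integral_sub (iG hφi) (iG hGi),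
      hφ.setIntegral_mul_fderiv hψ i]
    ring
  rw [key, enorm_neg]
  refine (enorm_add_le _ _).trans ?_
  refine (add_le_add (enorm_integral_le_lintegral_enorm _)
    (enorm_integral_le_lintegral_enorm _)).trans ?_
  have b1 : ∫⁻ x in Ω, ‖(φ x - u x) * fderiv ℝ ψ x (EuclideanSpace.single i 1)‖ₑ
      ≤ C * ∫⁻ x in Ω, ‖φ x - u x‖ₑ := by
    rw [← lintegral_const_mul' _ _ ENNReal.coe_ne_top]
    refine lintegral_mono fun x => ?_
    rw [enorm_mul, mul_comm]
    gcongr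
    exact ENNReal.coe_le_coe.2 (hd x)
  have b2 : ∫⁻ x in Ω, ‖(gradient φ x i - G x i) * ψ x‖ₑ
      ≤ C * ∫⁻ x in Ω, ‖gradient φ x - G x‖ₑ := by
    rw [← lintegral_const_mul' _ _ ENNReal.coe_ne_top]
    refine lintegral_mono fun x => ?_
    rw [enorm_mul, mul_comm]
    gcongr
    · exact ENNReal.coe_le_coe.2 (hC x)
    · exact enorm_le_iff_norm_le.2 (PiLp.norm_apply_le (gradient φ x - G x) i)
  refine (add_le_add b1 b2).trans ?_
  rw [← mul_add]
  gcongr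

/-- Weak gradients on an open set are unique up to null sets, by the fundamental lemma of the calculus
of variations. -/
lemma HasWeakGradient.ae_eq (hΩ : IsOpen Ω) {u : EuclideanSpace ℝ (Fin N) → ℝ}
    {G G' : EuclideanSpace ℝ (Fin N) → EuclideanSpace ℝ (Fin N)} (h : HasWeakGradient Ω u G)
    (h' : HasWeakGradient Ω u G') : G =ᵐ[volume.restrict Ω] G' := by
  have hi : ∀ i : Fin N, ∀ᵐ x ∂volume.restrict Ω, G x i = G' x i := by
    intro i
    have l : ∀ {G : EuclideanSpace ℝ (Fin N) → EuclideanSpace ℝ (Fin N)},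
        LocallyIntegrableOn G Ω → LocallyIntegrableOn (fun x => G x i) Ω := by
      intro G hG x hx
      obtain ⟨s, hs, hs'⟩ := hG x hx
      exact ⟨s, hs, hs'.euclidean_apply i⟩
    have := hΩ.ae_eq_zero_of_integral_contDiff_smul_eq_zero ((l h.2.1).sub (l h'.2.1)) ?_
    · rw [ae_restrict_iff' hΩ.measurableSet]
      filter_upwards [this] with x hx hxΩ
      simpa [sub_eq_zero] using hx hxΩ
    · intro g hg hgc hgs
      have ht : IsTestFunction Ω g := ⟨hg, hgc, hgs⟩
      have I : ∀ {G : EuclideanSpace ℝ (Fin N) → EuclideanSpace ℝ (Fin N)},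
          LocallyIntegrableOn G Ω → IntegrableOn (fun x => G x i * g x) Ω := by
        intro G hG
        have : IntegrableOn (fun x => G x i * g x) (tsupport g) := by
          obtain ⟨C, hC⟩ := hgc.exists_bound_of_continuous hg.continuous
          exact Integrable.mul_bdd (c := C)
            ((hG.integrableOn_compact_subset hgs hgc).euclidean_apply i)
            hg.continuous.aestronglyMeasurable (ae_of_all _ hC)
        refine (this.integrable_of_forall_notMem_eq_zero fun x hx => ?_).integrableOn
        rw [image_eq_zero_of_notMem_tsupport hx, mul_zero]
      rw [← setIntegral_eq_integral_of_forall_compl_eq_zero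
        (s := Ω) (fun x hx => by rw [ht.eq_zero_of_notMem hx, zero_smul])]
      have : ∀ x, g x • ((fun x => G x i) - fun x => G' x i) x = G x i * g x - G' x i * g x := by
        intro x; simp [mul_sub, mul_comm]
      simp_rw [this]
      rw [integral_sub (I h.2.1) (I h'.2.1)]
      linarith [h.2.2 g ht i, h'.2.2 g ht i]
  filter_upwards [ae_all_iff.2 hi] with x hx
  ext i
  exact hx i

lemma IsStrongLimit.hasWeakGradient_weakGradient {u : EuclideanSpace ℝ (Fin N) → ℝ}
    {G : EuclideanSpace ℝ (Fin N) → EuclideanSpace ℝ (Fin N)} (h : IsStrongLimit Ω u G) :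
    HasWeakGradient Ω u (weakGradient Ω u) := by
  have : ∃ G, HasWeakGradient Ω u G := ⟨G, h.hasWeakGradient⟩
  rw [weakGradient, dif_pos this]
  exact this.choose_spec

/-- The weak gradient chosen by `weakGradient` is almost everywhere the strong limit. -/
lemma IsStrongLimit.weakGradient_ae_eq (hΩ : IsOpen Ω) {u : EuclideanSpace ℝ (Fin N) → ℝ}
    {G : EuclideanSpace ℝ (Fin N) → EuclideanSpace ℝ (Fin N)} (h : IsStrongLimit Ω u G) :
    weakGradient Ω u =ᵐ[volume.restrict Ω] G :=
  h.hasWeakGradient_weakGradient.ae_eq hΩ h.hasWeakGradient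

lemma IsStrongLimit.congr {u u' : EuclideanSpace ℝ (Fin N) → ℝ}
    {G G' : EuclideanSpace ℝ (Fin N) → EuclideanSpace ℝ (Fin N)} (h : IsStrongLimit Ω u G)
    (hu : u =ᵐ[volume.restrict Ω] u') (hG : G =ᵐ[volume.restrict Ω] G') :
    IsStrongLimit Ω u' G' := by
  refine ⟨h.integrableOn.congr_fun_ae hu, h.integrableOn_grad.congr_fun_ae hG, fun ε hε => ?_⟩
  obtain ⟨φ, hφ, hle⟩ := h.approx ε hε
  refine ⟨φ, hφ, le_of_eq_of_le ?_ hle⟩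
  congr 1
  · exact lintegral_congr_ae (hu.mono fun x hx => by simp [hx])
  · exact lintegral_congr_ae (hG.mono fun x hx => by simp [hx])

lemma MemW11Zero.isStrongLimit {u : EuclideanSpace ℝ (Fin N) → ℝ} (h : MemW11Zero Ω u) :
    IsStrongLimit Ω u (weakGradient Ω u) := by
  obtain ⟨⟨h1, -, h3⟩, φ, hφ, hlim⟩ := h
  refine ⟨h1, h3, fun ε hε => ?_⟩
  obtain ⟨n, hn⟩ := (hlim.eventually_le_const (pos_iff_ne_zero.2 hε)).exists
  exact ⟨φ n, hφ n, hn⟩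

lemma IsStrongLimit.memW11Zero (hΩ : IsOpen Ω) {u : EuclideanSpace ℝ (Fin N) → ℝ}
    {G : EuclideanSpace ℝ (Fin N) → EuclideanSpace ℝ (Fin N)} (h : IsStrongLimit Ω u G) :
    MemW11Zero Ω u := by
  have hG := h.weakGradient_ae_eq hΩ
  refine ⟨⟨h.integrableOn, h.hasWeakGradient_weakGradient,
    h.integrableOn_grad.congr_fun_ae hG.symm⟩, ?_⟩
  have h' := h.congr .rfl hG.symm
  choose φ hφ hle using fun n : ℕ => h'.approx ((n : ℝ≥0∞)⁻¹) (by simp)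
  exact ⟨φ, hφ, tendsto_of_tendsto_of_tendsto_of_le_of_le tendsto_const_nhds
    ENNReal.tendsto_inv_nat_nhds_zero (fun _ => zero_le) hle⟩

lemma IsStrongLimit.zero : IsStrongLimit Ω (0 : EuclideanSpace ℝ (Fin N) → ℝ) 0 := by
  refine ⟨integrableOn_zero, integrableOn_zero, fun ε _ => ⟨0, IsTestFunction.zero, ?_⟩⟩
  have : gradient (0 : EuclideanSpace ℝ (Fin N) → ℝ) = 0 := by
    ext x; simp [gradient, fderiv_zero]
  simp [this]

end StrongLimit

/-! ### Polar coordinates -/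

section Polar

/-- The map sending `(e, x)` to the point at distance `‖x‖` of the origin in the direction `e`. -/
def rayMap (E : Type*) [NormedAddCommGroup E] [NormedSpace ℝ E]
    (p : Metric.sphere (0 : E) 1 × E) : E := ‖p.2‖ • p.1.1

lemma rayMap_preimage_ball {E : Type*} [NormedAddCommGroup E] [NormedSpace ℝ E] (R : ℝ) :
    rayMap E ⁻¹' Metric.ball 0 R = univ ×ˢ Metric.ball (0 : E) R := by
  ext p
  simp [rayMap, norm_smul]

variable {E : Type*} [NormedAddCommGroup E] [NormedSpace ℝ E] [MeasurableSpace E] [BorelSpace E]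
  [FiniteDimensional ℝ E] [Nontrivial E] (μ : Measure E) [μ.IsAddHaarMeasure]

lemma lintegral_eq_lintegral_toSphere_lintegral {H : E → ℝ≥0∞} (hH : Measurable H) :
    ∫⁻ x, H x ∂μ = ∫⁻ e, ∫⁻ r, H (r.1 • e.1)
      ∂(Measure.volumeIoiPow (Module.finrank ℝ E - 1)) ∂μ.toSphere := by
  have hm : Measurable fun p : Metric.sphere (0 : E) 1 × Ioi (0 : ℝ) => H (p.2.1 • p.1.1) :=
    hH.comp (by fun_prop)
  rw [← lintegral_prod _ hm.aemeasurable,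
    ← μ.measurePreserving_homeomorphUnitSphereProd.lintegral_comp hm]
  conv_lhs => rw [← restrict_compl_singleton (μ := μ) 0,
    ← lintegral_subtype_comap (measurableSet_singleton _).compl]
  refine lintegral_congr fun x => ?_
  have : ‖x.1‖ ≠ 0 := norm_ne_zero_iff.2 x.2
  simp [smul_smul, this]

lemma lintegral_norm_smul_sphere {H : E → ℝ≥0∞} (hH : Measurable H) (e : Metric.sphere (0 : E) 1) :
    ∫⁻ x, H (‖x‖ • e.1) ∂μ = μ.toSphere univ * ∫⁻ r, H (r.1 • e.1)
      ∂(Measure.volumeIoiPow (Module.finrank ℝ E - 1)) := by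
  have hm : Measurable fun x : E => H (‖x‖ • e.1) := hH.comp (by fun_prop)
  rw [lintegral_eq_lintegral_toSphere_lintegral μ hm]
  have : ∀ (e' : Metric.sphere (0 : E) 1) (r : Ioi (0 : ℝ)), ‖r.1 • e'.1‖ = r.1 := fun e' r => by
    simp [norm_smul, abs_of_pos r.2.out]
  simp_rw [this]
  rw [lintegral_const, mul_comm]

lemma measurePreserving_rayMap :
    MeasurePreserving (rayMap E) (μ.toSphere.prod μ) (μ.toSphere univ • μ) := by
  have hm : Measurable (rayMap E) := by unfold rayMap; fun_prop
  refine ⟨hm, Measure.ext fun s hs => ?_⟩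
  have h1 : Measurable (s.indicator (1 : E → ℝ≥0∞)) := measurable_one.indicator hs
  rw [← lintegral_indicator_one hs, lintegral_map h1 hm,
    lintegral_prod (fun p => s.indicator (1 : E → ℝ≥0∞) (rayMap E p))
      (h1.comp hm :).aemeasurable,
    Measure.smul_apply, ← lintegral_indicator_one hs,
    lintegral_eq_lintegral_toSphere_lintegral μ h1, smul_eq_mul, ← lintegral_const_mul]
  · exact lintegral_congr fun e => lintegral_norm_smul_sphere μ h1 e
  · have h2 : Measurable fun p : Metric.sphere (0 : E) 1 × Ioi (0 : ℝ) =>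
        s.indicator (1 : E → ℝ≥0∞) (p.2.1 • p.1.1) := h1.comp (by fun_prop)
    exact h2.lintegral_prod_right'

/-- The ray map multiplies the Lebesgue measure of a centred ball by the area of the sphere: this is
integration in polar coordinates. -/
lemma measurePreserving_rayMap_ball (R : ℝ) :
    MeasurePreserving (rayMap E) (μ.toSphere.prod (μ.restrict (Metric.ball 0 R)))
      (μ.toSphere univ • μ.restrict (Metric.ball 0 R)) := by
  have h := (measurePreserving_rayMap μ).restrict_preimage (s := Metric.ball 0 R)
    measurableSet_ball
  rwa [rayMap_preimage_ball, ← Measure.prod_restrict, Measure.restrict_univ,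
    Measure.restrict_smul] at h

lemma quasiMeasurePreserving_rayMap_ball (R : ℝ) :
    Measure.QuasiMeasurePreserving (rayMap E) (μ.toSphere.prod (μ.restrict (Metric.ball 0 R)))
      (μ.restrict (Metric.ball 0 R)) :=
  (measurePreserving_rayMap_ball μ R).quasiMeasurePreserving.mono_right
    Measure.smul_absolutelyContinuous

lemma lintegral_toSphere_lintegral_ball {R : ℝ} {H : E → ℝ≥0∞}
    (hH : AEMeasurable H (μ.restrict (Metric.ball 0 R))) :
    ∫⁻ e, ∫⁻ x in Metric.ball 0 R, H (‖x‖ • e.1) ∂μ ∂μ.toSphere =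
      μ.toSphere univ * ∫⁻ x in Metric.ball 0 R, H x ∂μ := by
  rw [← smul_eq_mul, ← lintegral_smul_measure, ← (measurePreserving_rayMap_ball μ R).map_eq,
    lintegral_map' _ (measurePreserving_rayMap_ball μ R).aemeasurable, lintegral_prod]
  · rfl
  · exact hH.comp_quasiMeasurePreserving (quasiMeasurePreserving_rayMap_ball μ R)
  · rw [(measurePreserving_rayMap_ball μ R).map_eq]
    exact hH.smul_measure _

lemma aemeasurable_lintegral_ball_rayMap {R : ℝ} {H : E → ℝ≥0∞}
    (hH : AEMeasurable H (μ.restrict (Metric.ball 0 R))) :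
    AEMeasurable (fun e : Metric.sphere (0 : E) 1 =>
      ∫⁻ x in Metric.ball 0 R, H (‖x‖ • e.1) ∂μ) μ.toSphere :=
  (hH.comp_quasiMeasurePreserving (quasiMeasurePreserving_rayMap_ball μ R)).lintegral_prod_right'

/-- Null sets of radii correspond to null sets of points. -/
lemma ae_norm_of_ae {p : ℝ → Prop} (h : ∀ᵐ r : ℝ, p r) : ∀ᵐ x ∂μ, p ‖x‖ := by
  obtain ⟨s, hs, hsm, hs0⟩ := exists_measurable_superset_of_null (ae_iff.1 h)
  have h1 : Measurable fun x : E => s.indicator (1 : ℝ → ℝ≥0∞) ‖x‖ :=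
    (measurable_one.indicator hsm).comp measurable_norm
  have : ∫⁻ x, s.indicator (1 : ℝ → ℝ≥0∞) ‖x‖ ∂μ = 0 := by
    rw [lintegral_eq_lintegral_toSphere_lintegral μ h1]
    refine (lintegral_congr fun e => ?_).trans lintegral_zero
    rw [lintegral_eq_zero_iff (by fun_prop)]
    refine (withDensity_absolutelyContinuous _ _).ae_le ?_
    have h2 : ∀ᵐ r : ℝ, r ∉ s := measure_eq_zero_iff_ae_notMem.1 hs0
    have h3 := (ae_restrict_iff_subtype (measurableSet_Ioi (a := (0 : ℝ)))).1
      (ae_restrict_of_ae (s := Ioi 0) h2)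
    filter_upwards [h3] with r hr
    simp [norm_smul, abs_of_pos r.2.out, hr]
  rw [lintegral_eq_zero_iff h1] at this
  filter_upwards [this] with x hx
  by_contra hp
  have : ‖x‖ ∈ s := hs hp
  simp [this] at hx

end Polar

/-! ### Restriction of a Sobolev function to a ray -/

section Rays

variable {N : ℕ}

/-- The radial function `x ↦ u(‖x‖ e)` taking on every sphere the value of `u` in direction `e`. -/
noncomputable def rayExtension (u : EuclideanSpace ℝ (Fin N) → ℝ)
    (e x : EuclideanSpace ℝ (Fin N)) : ℝ :=
  u (‖x‖ • e)

/-- The gradient of `rayExtension u e` when `u` has gradient `G`. -/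
noncomputable def rayGradient (G : EuclideanSpace ℝ (Fin N) → EuclideanSpace ℝ (Fin N))
    (e x : EuclideanSpace ℝ (Fin N)) : EuclideanSpace ℝ (Fin N) :=
  (inner ℝ (G (‖x‖ • e)) e * ‖x‖⁻¹) • x

lemma norm_rayGradient (G : EuclideanSpace ℝ (Fin N) → EuclideanSpace ℝ (Fin N))
    (e : EuclideanSpace ℝ (Fin N)) {x : EuclideanSpace ℝ (Fin N)} (hx : x ≠ 0) :
    ‖rayGradient G e x‖ = |inner ℝ (G (‖x‖ • e)) e| := by
  have := norm_ne_zero_iff.2 hx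
  rw [rayGradient, norm_smul, norm_mul, norm_inv, norm_norm, mul_assoc, inv_mul_cancel₀ this,
    mul_one, Real.norm_eq_abs]

lemma norm_rayGradient_le (G : EuclideanSpace ℝ (Fin N) → EuclideanSpace ℝ (Fin N))
    {e : EuclideanSpace ℝ (Fin N)} (he : ‖e‖ = 1) (x : EuclideanSpace ℝ (Fin N)) :
    ‖rayGradient G e x‖ ≤ ‖G (‖x‖ • e)‖ := by
  by_cases hx : x = 0
  · simp [rayGradient, hx]
  · rw [norm_rayGradient G e hx]
    simpa [he] using abs_real_inner_le_norm (G (‖x‖ • e)) e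

lemma rayGradient_sub (G G' : EuclideanSpace ℝ (Fin N) → EuclideanSpace ℝ (Fin N))
    (e x : EuclideanSpace ℝ (Fin N)) :
    rayGradient G e x - rayGradient G' e x = rayGradient (fun y => G y - G' y) e x := by
  simp only [rayGradient, inner_sub_left, sub_mul, sub_smul]

/-- A smooth approximation of the norm. -/
noncomputable def smoothNorm (δ : ℝ) (x : EuclideanSpace ℝ (Fin N)) : ℝ := √(δ ^ 2 + ‖x‖ ^ 2)

lemma smoothNorm_pos {δ : ℝ} (hδ : 0 < δ) (x : EuclideanSpace ℝ (Fin N)) : 0 < smoothNorm δ x :=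
  Real.sqrt_pos.2 (by positivity)

lemma norm_le_smoothNorm (δ : ℝ) (x : EuclideanSpace ℝ (Fin N)) : ‖x‖ ≤ smoothNorm δ x :=
  Real.le_sqrt_of_sq_le (by nlinarith [sq_nonneg δ])

lemma contDiff_smoothNorm {δ : ℝ} (hδ : 0 < δ) :
    ContDiff ℝ ∞ (smoothNorm δ : EuclideanSpace ℝ (Fin N) → ℝ) :=
  (contDiff_const.add (contDiff_norm_sq ℝ)).sqrt fun x => by positivity

lemma fderiv_smoothNorm {δ : ℝ} (hδ : 0 < δ) (x v : EuclideanSpace ℝ (Fin N)) :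
    fderiv ℝ (smoothNorm δ) x v = (smoothNorm δ x)⁻¹ * inner ℝ x v := by
  have h1 : HasFDerivAt (fun y : EuclideanSpace ℝ (Fin N) => δ ^ 2 + ‖y‖ ^ 2)
      ((2 : ℝ) • innerSL ℝ x) x := by
    simpa [ofNat_smul_eq_nsmul] using (hasStrictFDerivAt_norm_sq x).hasFDerivAt.const_add (δ ^ 2)
  have h2 := (h1.sqrt (by positivity : δ ^ 2 + ‖x‖ ^ 2 ≠ 0)).fderiv
  have h3 : (fun y : EuclideanSpace ℝ (Fin N) => √(δ ^ 2 + ‖y‖ ^ 2)) = smoothNorm δ := rfl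
  rw [h3] at h2
  rw [h2]
  simp [smoothNorm]
  ring

lemma tendsto_smoothNorm (x : EuclideanSpace ℝ (Fin N)) :
    Tendsto (fun n : ℕ => smoothNorm (1 / ((n : ℝ) + 1)) x) atTop (𝓝 ‖x‖) := by
  have h : Tendsto (fun n : ℕ => √((1 / ((n : ℝ) + 1)) ^ 2 + ‖x‖ ^ 2)) atTop
      (𝓝 (√((0 : ℝ) ^ 2 + ‖x‖ ^ 2))) :=
    ((tendsto_one_div_add_atTop_nhds_zero_nat.pow 2).add_const _).sqrt
  simpa [smoothNorm] using h

lemma IsTestFunction.smoothNorm_smul {R δ : ℝ} (hδ : 0 < δ) {φ : EuclideanSpace ℝ (Fin N) → ℝ}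
    (hφ : IsTestFunction (Metric.ball 0 R) φ) {e : EuclideanSpace ℝ (Fin N)} (he : ‖e‖ = 1) :
    IsTestFunction (Metric.ball 0 R)
      (fun x : EuclideanSpace ℝ (Fin N) => φ (smoothNorm δ x • e)) := by
  obtain ⟨r, hr, hsub⟩ := exists_lt_subset_ball (isClosed_tsupport φ) hφ.2.2
  have hs : Function.support (fun x : EuclideanSpace ℝ (Fin N) => φ (smoothNorm δ x • e)) ⊆
      Metric.closedBall 0 r := by
    intro x hx
    have := hsub (subset_tsupport φ hx)
    rw [mem_ball_zero_iff, norm_smul, he, mul_one, Real.norm_of_nonneg (smoothNorm_pos hδ x).le]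
      at this
    exact mem_closedBall_zero_iff.2 ((norm_le_smoothNorm δ x).trans this.le)
  refine ⟨hφ.1.comp ((contDiff_smoothNorm hδ).smul contDiff_const),
    .of_support_subset_isCompact (isCompact_closedBall 0 r) hs,
    (closure_minimal hs Metric.isClosed_closedBall).trans (Metric.closedBall_subset_ball hr)⟩

lemma IsTestFunction.gradient_smoothNorm_smul {Ω : Set (EuclideanSpace ℝ (Fin N))} {δ : ℝ}
    (hδ : 0 < δ) {φ : EuclideanSpace ℝ (Fin N) → ℝ} (hφ : IsTestFunction Ω φ)
    (e x : EuclideanSpace ℝ (Fin N)) :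
    gradient (fun x => φ (smoothNorm δ x • e)) x =
      (inner ℝ (gradient φ (smoothNorm δ x • e)) e * (smoothNorm δ x)⁻¹) • x := by
  refine ext_inner_right ℝ fun v => ?_
  have h1 : HasFDerivAt (fun x => smoothNorm δ x • e)
      ((fderiv ℝ (smoothNorm δ) x).smulRight e) x :=
    (((contDiff_smoothNorm hδ).differentiable (by simp)) x).hasFDerivAt.smul_const e
  have h2 := ((hφ.differentiable (smoothNorm δ x • e)).hasFDerivAt.comp x h1).fderiv
  rw [inner_gradient_eq_fderiv]
  change fderiv ℝ (φ ∘ fun x => smoothNorm δ x • e) x v = _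
  rw [h2, inner_smul_left, inner_gradient_eq_fderiv]
  simp [fderiv_smoothNorm hδ]
  ring

/-- The ray extension of a test function is only Lipschitz at the origin, but replacing `‖x‖` by
`√(δ² + ‖x‖²)` gives test functions which approximate it in `W^{1,1}`. -/
lemma IsTestFunction.exists_approx_rayExtension {R : ℝ} {φ : EuclideanSpace ℝ (Fin N) → ℝ}
    (hφ : IsTestFunction (Metric.ball 0 R) φ) {e : EuclideanSpace ℝ (Fin N)} (he : ‖e‖ = 1)
    (hN : N ≠ 0) {ε : ℝ≥0∞} (hε : ε ≠ 0) :
    ∃ ψ : EuclideanSpace ℝ (Fin N) → ℝ, IsTestFunction (Metric.ball 0 R) ψ ∧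
      (∫⁻ x in Metric.ball 0 R, ‖ψ x - rayExtension φ e x‖ₑ) +
        ∫⁻ x in Metric.ball 0 R, ‖gradient ψ x - rayGradient (gradient φ) e x‖ₑ ≤ ε := by
  have : NeZero N := ⟨hN⟩
  obtain ⟨C, hC, hC'⟩ := hφ.exists_bound
  set ψ : ℕ → EuclideanSpace ℝ (Fin N) → ℝ :=
    fun n x => φ (smoothNorm (1 / ((n : ℝ) + 1)) x • e) with hψdef
  have hδ : ∀ n : ℕ, 0 < 1 / ((n : ℝ) + 1) := fun n => by positivity
  have hψ : ∀ n, IsTestFunction (Metric.ball 0 R) (ψ n) := fun n => hφ.smoothNorm_smul (hδ n) he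
  have hfin : ∫⁻ _ in Metric.ball (0 : EuclideanSpace ℝ (Fin N)) R, (2 * C : ℝ≥0∞) ≠ ⊤ := by
    rw [setLIntegral_const]
    exact ENNReal.mul_ne_top (by finiteness) measure_ball_lt_top.ne
  have hb : ∀ {F : Type} [SeminormedAddCommGroup F] (a b : F), ‖a‖ ≤ C → ‖b‖ ≤ C →
      ‖a - b‖ₑ ≤ 2 * C := by
    intro F _ a b ha hb
    have h : ‖a - b‖₊ ≤ 2 * C := by
      refine (nnnorm_sub_le a b).trans ?_
      rw [two_mul]
      exact add_le_add ha hb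
    simpa [enorm_eq_nnnorm] using ENNReal.coe_le_coe.2 h
  have hgrad : ∀ n x, gradient (ψ n) x =
      (inner ℝ (gradient φ (smoothNorm (1 / ((n : ℝ) + 1)) x • e)) e *
      (smoothNorm (1 / ((n : ℝ) + 1)) x)⁻¹) • x := fun n x =>
    hφ.gradient_smoothNorm_smul (hδ n) e x
  have hgradC : ∀ n x, ‖gradient (ψ n) x‖ ≤ C := by
    intro n x
    rw [hgrad, norm_smul, norm_mul, norm_inv, Real.norm_of_nonneg (smoothNorm_pos (hδ n) x).le,
      mul_assoc]
    have h1 := (norm_inner_le_norm (𝕜 := ℝ) (gradient φ (smoothNorm (1 / ((n : ℝ) + 1)) x • e)) e)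
    rw [he, mul_one] at h1
    have h2 : (smoothNorm (1 / ((n : ℝ) + 1)) x)⁻¹ * ‖x‖ ≤ 1 := by
      rw [inv_mul_le_one₀ (smoothNorm_pos (hδ n) x)]
      exact norm_le_smoothNorm _ x
    calc _ ≤ (C : ℝ) * 1 := by
          exact mul_le_mul (h1.trans (hC' _)) h2
            (mul_nonneg (inv_nonneg.2 (smoothNorm_pos (hδ n) x).le) (norm_nonneg x)) C.2
      _ = C := mul_one _
  have hmray : Measurable fun x : EuclideanSpace ℝ (Fin N) => ‖x‖ • e := by fun_prop
  have hmg : Measurable (rayGradient (gradient φ) e) :=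
    (((hφ.continuous_gradient.measurable.comp hmray).inner measurable_const).mul
      measurable_norm.inv).smul measurable_id
  have t1 : Tendsto (fun n => ∫⁻ x in Metric.ball 0 R, ‖ψ n x - rayExtension φ e x‖ₑ) atTop
      (𝓝 (∫⁻ x in Metric.ball (0 : EuclideanSpace ℝ (Fin N)) R, 0)) := by
    refine tendsto_lintegral_of_dominated_convergence (fun _ => 2 * C) (fun n => ?_)
      (fun n => ae_of_all _ fun x => hb _ _ (hC _) (hC _)) hfin (ae_of_all _ fun x => ?_)
    · exact ((hψ n).continuous.measurable.sub (hφ.continuous.measurable.comp hmray)).enorm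
    · have : Tendsto (fun n => ψ n x) atTop (𝓝 (φ (‖x‖ • e))) :=
        (hφ.continuous.tendsto _).comp ((tendsto_smoothNorm x).smul_const e)
      have := (this.sub_const (rayExtension φ e x)).enorm
      simpa [rayExtension] using this
  have t2 : Tendsto (fun n => ∫⁻ x in Metric.ball 0 R,
      ‖gradient (ψ n) x - rayGradient (gradient φ) e x‖ₑ) atTop
      (𝓝 (∫⁻ x in Metric.ball (0 : EuclideanSpace ℝ (Fin N)) R, 0)) := by
    refine tendsto_lintegral_of_dominated_convergence (fun _ => 2 * C) (fun n => ?_)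
      (fun n => ae_of_all _ fun x => hb _ _ (hgradC n x)
        ((norm_rayGradient_le _ he x).trans (hC' _))) hfin ?_
    · exact ((hψ n).continuous_gradient.measurable.sub hmg).enorm
    · have h0 : ∀ᵐ x ∂volume.restrict (Metric.ball (0 : EuclideanSpace ℝ (Fin N)) R), x ≠ 0 :=
        ae_restrict_of_ae (by simp [ae_iff])
      filter_upwards [h0] with x hx
      have : Tendsto (fun n => gradient (ψ n) x) atTop (𝓝 (rayGradient (gradient φ) e x)) := by
        simp_rw [hgrad]
        refine Tendsto.smul_const (Tendsto.mul (Tendsto.inner ?_ tendsto_const_nhds)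
          ((tendsto_smoothNorm x).inv₀ (norm_ne_zero_iff.2 hx))) x
        exact (hφ.continuous_gradient.tendsto _).comp ((tendsto_smoothNorm x).smul_const e)
      simpa using (this.sub_const (rayGradient (gradient φ) e x)).enorm
  have t := t1.add t2
  simp only [lintegral_zero, add_zero] at t
  obtain ⟨n, hn⟩ := (t.eventually_le_const (pos_iff_ne_zero.2 hε)).exists
  exact ⟨ψ n, hψ n, hn⟩

/-- A sequence of functions tending to `0` in `L¹` has arbitrarily small members at almost every
point. -/
lemma ae_exists_lt_of_lintegral_le {α : Type*} [MeasurableSpace α] {ν : Measure α}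
    {D : ℕ → α → ℝ≥0∞} (hD : ∀ n, AEMeasurable (D n) ν) {c : ℝ≥0∞} (hc : c ≠ ⊤)
    (hle : ∀ n, ∫⁻ a, D n a ∂ν ≤ c * (n : ℝ≥0∞)⁻¹) :
    ∀ᵐ a ∂ν, ∀ ε : ℝ≥0∞, ε ≠ 0 → ∃ n, D n a < ε := by
  have hlim : ∫⁻ a, liminf (fun n => D n a) atTop ∂ν = 0 := by
    refine le_antisymm ((lintegral_liminf_le' hD).trans ?_) zero_le
    have t : Tendsto (fun n : ℕ => c * (n : ℝ≥0∞)⁻¹) atTop (𝓝 (c * 0)) :=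
      ENNReal.Tendsto.const_mul ENNReal.tendsto_inv_nat_nhds_zero (.inr hc)
    rw [mul_zero] at t
    rw [← t.liminf_eq]
    exact liminf_le_liminf (.of_forall hle)
  have hlm : AEMeasurable (fun a => liminf (fun n => D n a) atTop) ν := by
    refine ⟨fun a => liminf (fun n => (hD n).mk _ a) atTop,
      .liminf fun n => (hD n).measurable_mk, ?_⟩
    filter_upwards [ae_all_iff.2 fun n => (hD n).ae_eq_mk] with a ha
    simp_rw [ha]
  rw [lintegral_eq_zero_iff' hlm] at hlim
  filter_upwards [hlim] with a ha ε hε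
  exact (frequently_lt_of_liminf_lt (by isBoundedDefault)
    (ha.trans_lt (pos_iff_ne_zero.2 hε))).exists

/-- Approximation by test functions passes to almost every slice of a measure preserving
parametrization of `Ω` by a product space. -/
lemma IsStrongLimit.ae_slice {Ω : Set (EuclideanSpace ℝ (Fin N))}
    {u : EuclideanSpace ℝ (Fin N) → ℝ}
    {G : EuclideanSpace ℝ (Fin N) → EuclideanSpace ℝ (Fin N)} (h : IsStrongLimit Ω u G)
    {α β : Type*} [MeasurableSpace α] [MeasurableSpace β] {ν : Measure α} {ρ : Measure β}
    [SFinite ρ] {Ψ : α × β → EuclideanSpace ℝ (Fin N)} {c : ℝ≥0∞} (hc : c ≠ ⊤)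
    (hΨ : MeasurePreserving Ψ (ν.prod ρ) (c • volume.restrict Ω)) :
    ∀ᵐ a ∂ν, ∀ ε : ℝ≥0∞, ε ≠ 0 → ∃ φ : EuclideanSpace ℝ (Fin N) → ℝ, IsTestFunction Ω φ ∧
      (∫⁻ b, ‖φ (Ψ (a, b)) - u (Ψ (a, b))‖ₑ ∂ρ) +
        ∫⁻ b, ‖gradient φ (Ψ (a, b)) - G (Ψ (a, b))‖ₑ ∂ρ < ε := by
  -- along a sequence of approximations, Tonelli bounds the mean of the slice errors and Fatou's
  -- lemma shows that the errors have lower limit zero on almost every slice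
  choose φ hφ hle using fun n : ℕ => h.approx ((n : ℝ≥0∞)⁻¹) (by simp)
  have a1 : ∀ n, AEMeasurable (fun x => ‖φ n x - u x‖ₑ) (volume.restrict Ω) := fun n =>
    ((hφ n).continuous.aestronglyMeasurable.sub h.integrableOn.1).enorm
  have a2 : ∀ n, AEMeasurable (fun x => ‖gradient (φ n) x - G x‖ₑ) (volume.restrict Ω) := fun n =>
    ((hφ n).continuous_gradient.aestronglyMeasurable.sub h.integrableOn_grad.1).enorm
  have hm : ∀ {H : EuclideanSpace ℝ (Fin N) → ℝ≥0∞}, AEMeasurable H (volume.restrict Ω) →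
      AEMeasurable (fun p => H (Ψ p)) (ν.prod ρ) := fun hH =>
    (hH.smul_measure c).comp_quasiMeasurePreserving hΨ.quasiMeasurePreserving
  have hint : ∀ {H : EuclideanSpace ℝ (Fin N) → ℝ≥0∞}, AEMeasurable H (volume.restrict Ω) →
      ∫⁻ a, ∫⁻ b, H (Ψ (a, b)) ∂ρ ∂ν = c * ∫⁻ x in Ω, H x := fun {H} hH => by
    rw [← lintegral_prod (fun p => H (Ψ p)) (hm hH), ← smul_eq_mul, ← lintegral_smul_measure,
      ← hΨ.map_eq, lintegral_map' (by rw [hΨ.map_eq]; exact hH.smul_measure c) hΨ.aemeasurable]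
  filter_upwards [ae_exists_lt_of_lintegral_le (ν := ν) (c := c)
    (fun n => (hm (a1 n)).lintegral_prod_right'.add (hm (a2 n)).lintegral_prod_right') hc
    (fun n => by
      simp only [Pi.add_apply]
      rw [lintegral_add_left' (hm (a1 n)).lintegral_prod_right', hint (a1 n), hint (a2 n),
        ← mul_add]
      gcongr
      exact hle n)] with a ha ε hε
  obtain ⟨n, hn⟩ := ha ε hε
  exact ⟨φ n, hφ n, hn⟩

/-- For almost every direction `e`, the ray extension of a `W^{1,1}_0` function is a `W^{1,1}_0`
function. -/
lemma IsStrongLimit.ae_rayExtension (hN : N ≠ 0) {R : ℝ} {u : EuclideanSpace ℝ (Fin N) → ℝ}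
    {G : EuclideanSpace ℝ (Fin N) → EuclideanSpace ℝ (Fin N)}
    (h : IsStrongLimit (Metric.ball 0 R) u G) :
    ∀ᵐ e ∂(volume : Measure (EuclideanSpace ℝ (Fin N))).toSphere,
      IsStrongLimit (Metric.ball 0 R) (rayExtension u e.1) (rayGradient G e.1) := by
  have : NeZero N := ⟨hN⟩
  set μ : Measure (EuclideanSpace ℝ (Fin N)) := volume
  set B := Metric.ball (0 : EuclideanSpace ℝ (Fin N)) R
  have hcomp : ∀ {F : Type} [NormedAddCommGroup F] {v : EuclideanSpace ℝ (Fin N) → F},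
      IntegrableOn v B → Integrable (fun p => v (rayMap _ p)) (μ.toSphere.prod (μ.restrict B)) :=
    fun hv => (measurePreserving_rayMap_ball μ R).integrable_comp_of_integrable
      (hv.smul_measure (measure_ne_top _ _))
  have i1 := (hcomp h.integrableOn).prod_right_ae
  have i2 : Integrable (fun p : Metric.sphere (0 : EuclideanSpace ℝ (Fin N)) 1 ×
      EuclideanSpace ℝ (Fin N) => rayGradient G p.1 p.2) (μ.toSphere.prod (μ.restrict B)) := by
    have hG := hcomp h.integrableOn_grad
    refine hG.mono ?_ (ae_of_all _ fun p => norm_rayGradient_le G (by simp) p.2)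
    have m1 : AEStronglyMeasurable (fun p : Metric.sphere (0 : EuclideanSpace ℝ (Fin N)) 1 ×
      EuclideanSpace ℝ (Fin N) => p.1.1) (μ.toSphere.prod (μ.restrict B)) :=
      (by fun_prop : Continuous _).aestronglyMeasurable
    have m2 : AEStronglyMeasurable (fun p : Metric.sphere (0 : EuclideanSpace ℝ (Fin N)) 1 ×
      EuclideanSpace ℝ (Fin N) => ‖p.2‖⁻¹) (μ.toSphere.prod (μ.restrict B)) :=
      (by fun_prop : Measurable _).aestronglyMeasurable
    exact ((hG.1.inner m1).mul m2).smul measurable_snd.aestronglyMeasurable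
  filter_upwards [i1, i2.prod_right_ae,
    h.ae_slice (measure_ne_top _ _) (measurePreserving_rayMap_ball μ R)] with e h1 h2 h3
  refine ⟨h1, h2, fun ε hε => ?_⟩
  have hε2 : ε / 2 ≠ 0 := by simp [hε]
  -- approximate first `u` along the ray by a test function, then its ray extension, which is
  -- only Lipschitz, by a smooth function
  obtain ⟨φ, hφ, hn⟩ := h3 _ hε2
  have he : ‖e.1‖ = 1 := by simp
  obtain ⟨ψ, hψ, hψle⟩ := hφ.exists_approx_rayExtension he hN hε2
  refine ⟨ψ, hψ, ?_⟩
  have tri : ∀ {F : Type} [NormedAddCommGroup F] {a b c : EuclideanSpace ℝ (Fin N) → F},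
      AEStronglyMeasurable (fun x => a x - b x) (μ.restrict B) →
      ∫⁻ x in B, ‖a x - c x‖ₑ ≤ (∫⁻ x in B, ‖a x - b x‖ₑ) + ∫⁻ x in B, ‖b x - c x‖ₑ := by
    intro F _ a b c hab
    rw [← lintegral_add_left' hab.enorm]
    refine lintegral_mono fun x => ?_
    rw [← sub_add_sub_cancel (a x) (b x) (c x)]
    exact enorm_add_le _ _
  have hmray : Measurable fun x : EuclideanSpace ℝ (Fin N) => ‖x‖ • e.1 := by fun_prop
  have hmg : Measurable (rayGradient (gradient φ) e.1) :=
    (((hφ.continuous_gradient.measurable.comp hmray).inner measurable_const).mul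
      measurable_norm.inv).smul measurable_id
  have b1 := tri (a := ψ) (b := rayExtension φ e.1) (c := rayExtension u e.1)
    (hψ.continuous.measurable.sub
      (hφ.continuous.measurable.comp hmray)).aestronglyMeasurable
  have b2 := tri (a := gradient ψ) (b := rayGradient (gradient φ) e.1) (c := rayGradient G e.1)
    (hψ.continuous_gradient.measurable.sub hmg).aestronglyMeasurable
  have b3 : ∫⁻ x in B, ‖rayGradient (gradient φ) e.1 x - rayGradient G e.1 x‖ₑ ≤
      ∫⁻ x in B, ‖gradient φ (‖x‖ • e.1) - G (‖x‖ • e.1)‖ₑ := by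
    refine lintegral_mono fun x => ?_
    rw [rayGradient_sub]
    exact enorm_le_iff_norm_le.2 (norm_rayGradient_le _ he x)
  calc _ ≤ _ := add_le_add b1 (b2.trans (add_le_add_right b3 _))
    _ = _ := add_add_add_comm _ _ _ _
    _ ≤ ε / 2 + ε / 2 := add_le_add hψle hn.le
    _ = ε := ENNReal.add_halves ε

end Rays

/-! ### Preimages of null sets under functions of one variable -/

section OneVariable

/-- A set which is mapped to a null set with invertible derivative is a null set. -/
lemma measure_eq_zero_of_image_eq_zero {E : Type*} [NormedAddCommGroup E] [NormedSpace ℝ E]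
    [FiniteDimensional ℝ E] [MeasurableSpace E] [BorelSpace E] (μ : Measure E) [μ.IsAddHaarMeasure]
    {f : E → E} {f' : E → E →L[ℝ] E} {s : Set E}
    (hf' : ∀ x ∈ s, HasFDerivWithinAt f (f' x) s x) (hdet : ∀ x ∈ s, (f' x).det ≠ 0)
    (hs : μ (f '' s) = 0) : μ s = 0 := by
  have key : ∀ A : E →L[ℝ] E, ∃ δ : ℝ≥0, δ ≠ 0 ∧
      (A.det ≠ 0 → ∀ t : Set E, ApproximatesLinearOn f A t δ → μ (f '' t) = 0 → μ t = 0) := by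
    intro A
    by_cases hA : A.det = 0
    · exact ⟨1, one_ne_zero, fun h => absurd hA h⟩
    · obtain ⟨m, hm0, hm⟩ := ENNReal.lt_iff_exists_nnreal_btwn.1
        (ENNReal.ofReal_pos.2 (abs_pos.2 hA))
      obtain ⟨δ, hδ, hδ0⟩ :=
        ((mul_le_addHaar_image_of_lt_det μ A hm).and self_mem_nhdsWithin).exists
      refine ⟨δ, (show (0 : ℝ≥0) < δ from hδ0).ne', fun _ t ht h0 => ?_⟩
      have := hδ t f ht
      rw [h0, nonpos_iff_eq_zero, mul_eq_zero] at this
      exact this.resolve_left hm0.ne'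
  choose r hr hr' using key
  rcases s.eq_empty_or_nonempty with rfl | hne
  · simp
  obtain ⟨t, A, -, -, hst, happ, hA⟩ :=
    exists_partition_approximatesLinearOn_of_hasFDerivWithinAt f s f' hf' r hr
  have : s ⊆ ⋃ n, s ∩ t n := by
    rw [← inter_iUnion]
    exact subset_inter subset_rfl hst
  refine measure_mono_null this (measure_iUnion_null fun n => ?_)
  obtain ⟨y, hy, hAy⟩ := hA hne n
  exact hr' _ (hAy ▸ hdet y hy) _ (happ n)
    (measure_mono_null (image_mono inter_subset_left) hs)

/-- If `w` is the limit in `W^{1,1}(0,1)` of continuously differentiable functions whose derivatives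
tend to `h`, then `w` is almost everywhere equal to a primitive of `h`. -/
lemma ae_eq_primitive_of_approx {w h : ℝ → ℝ}
    (hw : AEStronglyMeasurable w (volume.restrict (Ioc 0 1)))
    (hh : IntegrableOn h (Ioc 0 1))
    (happ : ∀ ε : ℝ≥0∞, ε ≠ 0 → ∃ g g' : ℝ → ℝ, (∀ t, HasDerivAt g (g' t) t) ∧ Continuous g' ∧
      (∫⁻ t in Ioc 0 1, ‖g t - w t‖ₑ) + ∫⁻ t in Ioc 0 1, ‖g' t - h t‖ₑ ≤ ε) :
    ∃ c, ∀ᵐ t ∂volume.restrict (Ioc 0 1), w t = c + ∫ s in (0)..t, h s := by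
  set P : ℝ → ℝ := fun t => ∫ s in (0)..t, h s with hP
  set k : ℝ → ℝ := fun t => w t - P t with hk
  have hII : IntervalIntegrable h volume 0 1 := (intervalIntegrable_iff_integrableOn_Ioc_of_le
    zero_le_one).2 hh
  have hPm : AEStronglyMeasurable P (volume.restrict (Ioc 0 1)) :=
    ((intervalIntegral.continuousOn_primitive_interval' hII left_mem_uIcc).mono
      (by rw [uIcc_of_le zero_le_one]; exact Ioc_subset_Icc_self)).aestronglyMeasurable
      measurableSet_Ioc
  have hkm : AEStronglyMeasurable k (volume.restrict (Ioc 0 1)) := hw.sub hPm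
  have : IsProbabilityMeasure (volume.restrict (Ioc (0 : ℝ) 1)) := ⟨by simp⟩
  -- `k` is as close as we please to a constant
  have hconst : ∀ ε : ℝ≥0∞, ε ≠ 0 → ∃ c : ℝ, ∫⁻ t in Ioc 0 1, ‖k t - c‖ₑ ≤ ε := by
    intro ε hε
    obtain ⟨g, g', hg, hg', hle⟩ := happ ε hε
    refine ⟨g 0, le_trans ?_ hle⟩
    have hgc : Continuous g := continuous_iff_continuousAt.2 fun t => (hg t).continuousAt
    have hpt : ∀ t ∈ Ioc (0 : ℝ) 1,
        ‖k t - g 0‖ₑ ≤ ‖g t - w t‖ₑ + ∫⁻ s in Ioc 0 1, ‖g' s - h s‖ₑ := by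
      intro t ht
      have hht : IntervalIntegrable h volume 0 t :=
        hII.mono_set (uIcc_subset_uIcc_left (by rw [uIcc_of_le zero_le_one]; exact ⟨ht.1.le, ht.2⟩))
      have hft : ∫ s in (0)..t, g' s = g t - g 0 :=
        intervalIntegral.integral_eq_sub_of_hasDerivAt (fun s _ => hg s)
          (hg'.intervalIntegrable _ _)
      have e : k t - g 0 = -(g t - w t) + ∫ s in (0)..t, (g' s - h s) := by
        rw [intervalIntegral.integral_sub (hg'.intervalIntegrable _ _) hht, hft]
        simp only [hk, hP]
        ring
      rw [e]
      refine (enorm_add_le _ _).trans ?_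
      rw [enorm_neg, intervalIntegral.integral_of_le ht.1.le]
      gcongr
      exact (enorm_integral_le_lintegral_enorm _).trans
        (lintegral_mono_set (Ioc_subset_Ioc_right ht.2))
    refine (setLIntegral_mono' measurableSet_Ioc hpt).trans ?_
    have hgw : AEMeasurable (fun t => ‖g t - w t‖ₑ) (volume.restrict (Ioc (0 : ℝ) 1)) :=
      (hgc.aestronglyMeasurable.sub hw).enorm
    rw [lintegral_add_left' hgw, lintegral_const, measure_univ, mul_one]
  -- hence the mean oscillation of `k` vanishes, and `k` is almost everywhere constant
  have hdouble : ∫⁻ t in Ioc (0 : ℝ) 1, ∫⁻ s in Ioc (0 : ℝ) 1, ‖k s - k t‖ₑ = 0 := by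
    refine le_antisymm (le_of_forall_pos_le_add fun ε hε => ?_) zero_le
    obtain ⟨c, hc⟩ := hconst (ε / 2) (by simpa using hε.ne')
    have hkc : AEMeasurable (fun t => ‖k t - c‖ₑ) (volume.restrict (Ioc (0 : ℝ) 1)) :=
      (hkm.sub aestronglyMeasurable_const).enorm
    rw [zero_add]
    calc _ ≤ ∫⁻ t in Ioc (0 : ℝ) 1, ∫⁻ s in Ioc (0 : ℝ) 1, (‖k s - c‖ₑ + ‖k t - c‖ₑ) := by
          refine lintegral_mono fun t => lintegral_mono fun s => ?_
          have : k s - k t = (k s - c) - (k t - c) := by ring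
          rw [this]
          exact enorm_sub_le
      _ = (∫⁻ s in Ioc (0 : ℝ) 1, ‖k s - c‖ₑ) + ∫⁻ t in Ioc (0 : ℝ) 1, ‖k t - c‖ₑ := by
          simp_rw [lintegral_add_left' hkc, lintegral_const, measure_univ, mul_one]
          rw [lintegral_add_left measurable_const, lintegral_const, measure_univ, mul_one]
      _ ≤ ε / 2 + ε / 2 := add_le_add hc hc
      _ = ε := ENNReal.add_halves ε
  have hm2 : AEMeasurable (fun p : ℝ × ℝ => ‖k p.2 - k p.1‖ₑ)
      ((volume.restrict (Ioc (0 : ℝ) 1)).prod (volume.restrict (Ioc (0 : ℝ) 1))) :=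
    (hkm.comp_snd.sub hkm.comp_fst).enorm
  rw [lintegral_eq_zero_iff' hm2.lintegral_prod_right'] at hdouble
  obtain ⟨t, ht⟩ := hdouble.exists
  refine ⟨k t, ?_⟩
  have hkt : AEMeasurable (fun s => ‖k s - k t‖ₑ) (volume.restrict (Ioc (0 : ℝ) 1)) :=
    (hkm.sub aestronglyMeasurable_const).enorm
  replace ht := (lintegral_eq_zero_iff' hkt).1 ht
  filter_upwards [ht] with s hs
  have : k s - k t = 0 := enorm_eq_zero.1 hs
  simp only [hk] at this ⊢
  linarith

/-- The derivative of an absolutely continuous function vanishes almost everywhere on the preimage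
of a null set. -/
lemma ae_deriv_eq_zero_of_mem_null {w h : ℝ → ℝ} {c : ℝ} (hh : IntegrableOn h (Ioc 0 1))
    (hw : ∀ᵐ t ∂volume.restrict (Ioc 0 1), w t = c + ∫ s in (0)..t, h s) {Z : Set ℝ}
    (hZ : volume Z = 0) : ∀ᵐ t ∂volume.restrict (Ioc 0 1), w t ∈ Z → h t = 0 := by
  have hII : IntervalIntegrable h volume 0 1 := (intervalIntegrable_iff_integrableOn_Ioc_of_le
    zero_le_one).2 hh
  set g : ℝ → ℝ := fun t => c + ∫ s in (0)..t, h s with hg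
  set s : Set ℝ := {t | HasDerivAt g (h t) t ∧ h t ≠ 0 ∧ g t ∈ Z} with hs
  have hs0 : volume s = 0 := by
    refine measure_eq_zero_of_image_eq_zero volume (f := g)
      (f' := fun t => ContinuousLinearMap.toSpanSingleton ℝ (h t))
      (fun t ht => ht.1.hasFDerivAt.hasFDerivWithinAt) (fun t ht => ?_)
      (measure_mono_null (image_subset_iff.2 fun t ht => ht.2.2) hZ)
    simpa using ht.2.1
  have h1 : ∀ᵐ t ∂volume.restrict (Ioc (0 : ℝ) 1), HasDerivAt g (h t) t := by
    rw [ae_restrict_iff' measurableSet_Ioc]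
    filter_upwards [hII.ae_hasDerivAt_integral] with t ht ht'
    rw [uIcc_of_le zero_le_one] at ht
    exact (ht (Ioc_subset_Icc_self ht') 0 ⟨le_rfl, zero_le_one⟩).const_add c
  filter_upwards [hw, h1, ae_restrict_of_ae (measure_eq_zero_iff_ae_notMem.1 hs0)]
    with t h1 h2 h3 h4
  by_contra h5
  exact h3 ⟨h2, h5, by rwa [h1] at h4⟩

end OneVariable

/-! ### Rotations in a plane and tangential derivatives -/

section PlaneRotation

variable {E : Type*} [NormedAddCommGroup E] [InnerProductSpace ℝ E]

/-- The infinitesimal generator of the rotations in the plane spanned by the orthonormal vectors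
`a` and `b`. -/
noncomputable def planeGenerator (a b x : E) : E := inner ℝ a x • b - inner ℝ b x • a

/-- The rotation of angle `t` in the plane spanned by the orthonormal vectors `a` and `b`, which
fixes the orthogonal complement of this plane. -/
noncomputable def planeRotation (a b : E) (t : ℝ) (x : E) : E :=
  x + ((Real.cos t - 1) * inner ℝ a x - Real.sin t * inner ℝ b x) • a +
    (Real.sin t * inner ℝ a x + (Real.cos t - 1) * inner ℝ b x) • b

lemma continuous_planeGenerator (a b : E) : Continuous (planeGenerator a b) := by
  unfold planeGenerator; fun_prop

lemma continuous_planeRotation (a b : E) :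
    Continuous fun p : E × ℝ => planeRotation a b p.2 p.1 := by
  unfold planeRotation; fun_prop

lemma continuous_planeRotation_angle (a b x : E) : Continuous fun t => planeRotation a b t x := by
  unfold planeRotation; fun_prop

@[simp] lemma planeRotation_zero (a b x : E) : planeRotation a b 0 x = x := by
  simp [planeRotation]

/-- The vectors `a` and `b` are orthogonal unit vectors. -/
structure IsOrthonormalPair (a b : E) : Prop where
  norm_left : ‖a‖ = 1
  norm_right : ‖b‖ = 1
  inner_eq_zero : inner ℝ a b = 0

namespace IsOrthonormalPair

variable {a b : E}

lemma norm_planeGenerator_le (h : IsOrthonormalPair a b) (x : E) :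
    ‖planeGenerator a b x‖ ≤ 2 * ‖x‖ := by
  have h1 := abs_real_inner_le_norm a x
  have h2 := abs_real_inner_le_norm b x
  refine (norm_sub_le _ _).trans ?_
  rw [norm_smul, norm_smul, h.norm_left, h.norm_right, Real.norm_eq_abs, Real.norm_eq_abs]
  rw [h.norm_left, one_mul] at h1
  rw [h.norm_right, one_mul] at h2
  linarith

lemma inner_self_left (h : IsOrthonormalPair a b) : inner ℝ a a = 1 := by
  rw [real_inner_self_eq_norm_sq, h.norm_left, one_pow]

lemma inner_self_right (h : IsOrthonormalPair a b) : inner ℝ b b = 1 := by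
  rw [real_inner_self_eq_norm_sq, h.norm_right, one_pow]

lemma inner_eq_zero' (h : IsOrthonormalPair a b) : inner ℝ b a = 0 := by
  rw [real_inner_comm, h.inner_eq_zero]

lemma norm_planeRotation (h : IsOrthonormalPair a b) (t : ℝ) (x : E) :
    ‖planeRotation a b t x‖ = ‖x‖ := by
  refine (sq_eq_sq₀ (norm_nonneg _) (norm_nonneg _)).1 ?_
  rw [← real_inner_self_eq_norm_sq, ← real_inner_self_eq_norm_sq]
  simp only [planeRotation, inner_add_left, inner_add_right, inner_smul_left, inner_smul_right,
    h.inner_self_left, h.inner_self_right, h.inner_eq_zero, h.inner_eq_zero',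
    real_inner_comm a x, real_inner_comm b x, conj_trivial]
  linear_combination (inner ℝ a x ^ 2 + inner ℝ b x ^ 2) * Real.sin_sq_add_cos_sq t

lemma hasDerivAt_planeRotation (h : IsOrthonormalPair a b) (t : ℝ) (x : E) :
    HasDerivAt (fun t => planeRotation a b t x) (planeGenerator a b (planeRotation a b t x)) t := by
  have hc := Real.hasDerivAt_cos t
  have hs := Real.hasDerivAt_sin t
  have := ((((hc.sub_const 1).mul_const (inner ℝ a x)).sub (hs.mul_const (inner ℝ b x))).smul_const
    a |>.const_add x).add (((hs.mul_const (inner ℝ a x)).add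
    ((hc.sub_const 1).mul_const (inner ℝ b x))).smul_const b)
  refine this.congr_deriv ?_
  simp only [planeGenerator, planeRotation, inner_add_right, inner_smul_right,
    h.inner_self_left, h.inner_self_right, h.inner_eq_zero, h.inner_eq_zero']
  module

/-- A plane rotation as a linear isometry. -/
noncomputable def rotation (h : IsOrthonormalPair a b) (t : ℝ) : E →ₗᵢ[ℝ] E where
  toFun := planeRotation a b t
  map_add' x y := by simp only [planeRotation, inner_add_right]; module
  map_smul' c x := by simp only [planeRotation, inner_smul_right, RingHom.id_apply]; module
  norm_map' := h.norm_planeRotation t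

/-- Rotations in suitable planes through `e` move `‖x‖ e` to any given point `x`. -/
lemma exists_planeRotation_eq [FiniteDimensional ℝ E] (hE : 2 ≤ Module.finrank ℝ E) {e : E}
    (he : ‖e‖ = 1) (x : E) :
    ∃ b t, IsOrthonormalPair e b ∧ planeRotation e b t (‖x‖ • e) = x := by
  have hee : inner ℝ e e = 1 := by rw [real_inner_self_eq_norm_sq, he, one_pow]
  obtain ⟨b, hb, hxb⟩ : ∃ b, IsOrthonormalPair e b ∧
      x = (inner ℝ e x : ℝ) • e + (inner ℝ b x : ℝ) • b := by
    set y := x - (inner ℝ e x : ℝ) • e with hy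
    have hey : inner ℝ e y = 0 := by
      rw [hy, inner_sub_right, inner_smul_right, hee, mul_one, sub_self]
    -- if `x` is a multiple of `e`, any unit vector orthogonal to `e` will do
    by_cases hy0 : y = 0
    · have hx : x = (inner ℝ e x : ℝ) • e := sub_eq_zero.1 hy0
      have hlt : Module.finrank ℝ (ℝ ∙ e) < Module.finrank ℝ E :=
        (finrank_span_singleton (K := ℝ) (norm_ne_zero_iff.1 (he ▸ one_ne_zero))).trans_lt hE
      have hne : (ℝ ∙ e)ᗮ ≠ ⊥ := fun hbot => by
        rw [Submodule.orthogonal_eq_bot_iff] at hbot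
        rw [hbot, finrank_top] at hlt
        exact hlt.false
      obtain ⟨z, hz, hz0⟩ := Submodule.exists_mem_ne_zero_of_ne_bot hne
      have hez := Submodule.mem_orthogonal_singleton_iff_inner_right.1 hz
      refine ⟨‖z‖⁻¹ • z, ⟨he, norm_smul_inv_norm (𝕜 := ℝ) hz0, by simp [inner_smul_right, hez]⟩, ?_⟩
      have : inner ℝ (‖z‖⁻¹ • z) x = (0 : ℝ) := by
        rw [hx, inner_smul_left, inner_smul_right, real_inner_comm e z, hez]; simp
      rw [this, zero_smul, add_zero]
      exact hx
    · have hyn := norm_ne_zero_iff.2 hy0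
      refine ⟨‖y‖⁻¹ • y, ⟨he, norm_smul_inv_norm (𝕜 := ℝ) hy0, by simp [inner_smul_right, hey]⟩, ?_⟩
      have hyx : inner ℝ y x = ‖y‖ ^ 2 := by
        have : x = y + (inner ℝ e x : ℝ) • e := by simp [hy]
        conv_lhs => rw [this]
        rw [inner_add_right, inner_smul_right, real_inner_comm e y, hey, real_inner_self_eq_norm_sq]
        simp
      rw [inner_smul_left, hyx, smul_smul]
      have : (starRingEnd ℝ) ‖y‖⁻¹ * ‖y‖ ^ 2 * ‖y‖⁻¹ = 1 := by
        simp only [conj_trivial]; field_simp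
      rw [this, one_smul, hy]
      abel
  -- the angle is the argument of `x` in the oriented plane `(e, b)`
  set z : ℂ := ⟨inner ℝ e x, inner ℝ b x⟩ with hz
  have hxz : ‖x‖ = ‖z‖ := by
    refine (sq_eq_sq₀ (norm_nonneg _) (norm_nonneg _)).1 ?_
    rw [← Complex.normSq_eq_norm_sq, Complex.normSq_apply, ← real_inner_self_eq_norm_sq]
    conv_lhs => rw [hxb]
    simp only [inner_add_left, inner_add_right, inner_smul_left, inner_smul_right, hee,
      hb.inner_self_right, hb.inner_eq_zero, hb.inner_eq_zero', conj_trivial, hz]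
    ring
  refine ⟨b, z.arg, hb, ?_⟩
  have h1 : ‖z‖ * Real.cos z.arg = inner ℝ e x := Complex.norm_mul_cos_arg z
  have h2 : ‖z‖ * Real.sin z.arg = inner ℝ b x := Complex.norm_mul_sin_arg z
  conv_rhs => rw [hxb, ← h1, ← h2]
  simp only [planeRotation, inner_smul_right, hee, hb.inner_eq_zero', hxz]
  module

end IsOrthonormalPair

lemma IsOrthonormalPair.measurePreserving_planeRotation [MeasurableSpace E] [BorelSpace E]
    [FiniteDimensional ℝ E] {a b : E} (h : IsOrthonormalPair a b) (t : ℝ) :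
    MeasurePreserving (planeRotation a b t) (volume : Measure E) volume :=
  ((h.rotation t).toLinearIsometryEquiv rfl).measurePreserving

lemma IsOrthonormalPair.measurePreserving_planeRotation_ball [MeasurableSpace E] [BorelSpace E]
    [FiniteDimensional ℝ E] {a b : E} (h : IsOrthonormalPair a b) (R t : ℝ) :
    MeasurePreserving (planeRotation a b t) ((volume : Measure E).restrict (Metric.ball 0 R))
      (volume.restrict (Metric.ball 0 R)) := by
  have := (h.measurePreserving_planeRotation t).restrict_preimage (s := Metric.ball 0 R)
    measurableSet_ball
  have hp : planeRotation a b t ⁻¹' Metric.ball 0 R = Metric.ball (0 : E) R := by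
    ext x; simp [h.norm_planeRotation]
  rwa [hp] at this

/-- Moving a random point of a ball by an independent random rotation does not change its law. -/
lemma IsOrthonormalPair.measurePreserving_planeRotation_prod [MeasurableSpace E] [BorelSpace E]
    [FiniteDimensional ℝ E] {a b : E} (h : IsOrthonormalPair a b) (R : ℝ) (ν : Measure ℝ)
    [SFinite ν] :
    MeasurePreserving (fun p : E × ℝ => planeRotation a b p.2 p.1)
      (((volume : Measure E).restrict (Metric.ball 0 R)).prod ν)
      (ν univ • volume.restrict (Metric.ball 0 R)) := by
  have hm := (continuous_planeRotation a b).measurable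
  refine ⟨hm, Measure.ext fun s hs => ?_⟩
  rw [Measure.map_apply hm hs, Measure.prod_apply_symm (hm hs)]
  have : ∀ t, (volume : Measure E).restrict (Metric.ball 0 R)
      ((fun x => (x, t)) ⁻¹' ((fun p : E × ℝ => planeRotation a b p.2 p.1) ⁻¹' s)) =
      (volume : Measure E).restrict (Metric.ball 0 R) s := fun t =>
    (h.measurePreserving_planeRotation_ball R t).measure_preimage hs.nullMeasurableSet
  simp_rw [this, lintegral_const, Measure.smul_apply, smul_eq_mul, mul_comm]

end PlaneRotation

section Tangential

variable {N : ℕ} {R : ℝ} {u : EuclideanSpace ℝ (Fin N) → ℝ}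
  {G : EuclideanSpace ℝ (Fin N) → EuclideanSpace ℝ (Fin N)}

lemma IsTestFunction.hasDerivAt_planeRotation {Ω : Set (EuclideanSpace ℝ (Fin N))}
    {φ : EuclideanSpace ℝ (Fin N) → ℝ} (hφ : IsTestFunction Ω φ)
    {a b : EuclideanSpace ℝ (Fin N)} (hab : IsOrthonormalPair a b)
    (x : EuclideanSpace ℝ (Fin N)) (t : ℝ) :
    HasDerivAt (fun t => φ (planeRotation a b t x)) (inner ℝ (gradient φ (planeRotation a b t x))
      (planeGenerator a b (planeRotation a b t x))) t := by
  rw [inner_gradient_eq_fderiv]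
  exact (hφ.differentiable _).hasFDerivAt.comp_hasDerivAt t (hab.hasDerivAt_planeRotation t x)

lemma IsTestFunction.continuous_inner_planeGenerator {Ω : Set (EuclideanSpace ℝ (Fin N))}
    {φ : EuclideanSpace ℝ (Fin N) → ℝ} (hφ : IsTestFunction Ω φ)
    (a b : EuclideanSpace ℝ (Fin N)) :
    Continuous fun x => inner ℝ (gradient φ x) (planeGenerator a b x) :=
  hφ.continuous_gradient.inner (continuous_planeGenerator a b)

lemma IsOrthonormalPair.enorm_inner_planeGenerator_le {a b : EuclideanSpace ℝ (Fin N)}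
    (hab : IsOrthonormalPair a b) (y x : EuclideanSpace ℝ (Fin N)) :
    ‖inner ℝ y (planeGenerator a b x)‖ₑ ≤ (2 * ‖x‖₊ : ℝ≥0) * ‖y‖ₑ := by
  have h : ‖inner ℝ y (planeGenerator a b x)‖₊ ≤ (2 * ‖x‖₊) * ‖y‖₊ := by
    rw [← NNReal.coe_le_coe]
    push_cast
    calc _ ≤ ‖y‖ * ‖planeGenerator a b x‖ := norm_inner_le_norm _ _
      _ ≤ ‖y‖ * (2 * ‖x‖) := by gcongr; exact hab.norm_planeGenerator_le x
      _ = _ := mul_comm _ _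
  simpa only [enorm_eq_nnnorm, ← ENNReal.coe_mul] using ENNReal.coe_le_coe.2 h

/-- A tangential derivative of `u` vanishes almost everywhere on the set where `(‖x‖, u x)` lies in
a given null set of the plane: tangential derivatives are computed along circles, on which `‖x‖` is
constant and `u` is absolutely continuous. -/
lemma IsStrongLimit.ae_inner_planeGenerator_eq_zero_of_mem_null
    (h : IsStrongLimit (Metric.ball 0 R) u G) (hN : N ≠ 0) {a b : EuclideanSpace ℝ (Fin N)}
    (hab : IsOrthonormalPair a b) {Z : Set (ℝ × ℝ)} (hZ : volume Z = 0) :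
    ∀ᵐ x ∂volume.restrict (Metric.ball (0 : EuclideanSpace ℝ (Fin N)) R),
      (‖x‖, u x) ∈ Z → inner ℝ (G x) (planeGenerator a b x) = 0 := by
  have : NeZero N := ⟨hN⟩
  wlog hm : Measurable u ∧ Measurable G ∧ MeasurableSet Z generalizing u G Z
  · have hu := h.integrableOn.1
    have hG := h.integrableOn_grad.1
    filter_upwards [this (h.congr hu.ae_eq_mk hG.ae_eq_mk) ((measure_toMeasurable Z).trans hZ)
      ⟨hu.stronglyMeasurable_mk.measurable, hG.stronglyMeasurable_mk.measurable,
        measurableSet_toMeasurable _ _⟩, hu.ae_eq_mk, hG.ae_eq_mk] with x h1 h2 h3 h4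
    rw [h3]
    exact h1 (h2 ▸ subset_toMeasurable _ _ h4)
  obtain ⟨hu, hG, hZm⟩ := hm
  set B := Metric.ball (0 : EuclideanSpace ℝ (Fin N)) R with hB
  set ρ : Measure ℝ := volume.restrict (Ioc 0 1) with hρ
  set Ψ : EuclideanSpace ℝ (Fin N) × ℝ → EuclideanSpace ℝ (Fin N) :=
    fun p => planeRotation a b p.2 p.1 with hΨdef
  have hΨ : MeasurePreserving Ψ ((volume.restrict B).prod ρ) (ρ univ • volume.restrict B) :=
    hab.measurePreserving_planeRotation_prod R ρ
  have hρ1 : ρ univ = 1 := by simp [hρ]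
  have hΨm : Measurable Ψ := hΨ.measurable
  set S : Set (EuclideanSpace ℝ (Fin N)) :=
    {x | (‖x‖, u x) ∈ Z ∧ inner ℝ (G x) (planeGenerator a b x) ≠ 0} with hS
  have hKm : Measurable fun x => inner ℝ (G x) (planeGenerator a b x) :=
    hG.inner (continuous_planeGenerator a b).measurable
  have hSm : MeasurableSet S :=
    ((measurable_norm.prodMk hu) hZm).inter (hKm (measurableSet_singleton 0).compl)
  -- the exceptional set `S` is preserved in measure when pulled back along random rotations, so it
  -- suffices that almost every circle meets it in a null set of angles
  suffices hnull : ((volume.restrict B).prod ρ) (Ψ ⁻¹' S) = 0 by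
    rw [hΨ.measure_preimage hSm.nullMeasurableSet, hρ1, one_smul] at hnull
    filter_upwards [measure_eq_zero_iff_ae_notMem.1 hnull] with x hx hxZ
    by_contra hne
    exact hx ⟨hxZ, hne⟩
  rw [Measure.measure_prod_null (hΨm hSm)]
  have hZr : ∀ᵐ x : EuclideanSpace ℝ (Fin N), volume {y | (‖x‖, y) ∈ Z} = 0 := by
    refine ae_norm_of_ae volume (p := fun r => volume {y | (r, y) ∈ Z} = 0) ?_
    have : (volume : Measure (ℝ × ℝ)) = (volume : Measure ℝ).prod volume := rfl
    rw [this, Measure.measure_prod_null hZm] at hZ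
    exact hZ
  have hGi := (hΨ.integrable_comp_of_integrable
    (h.integrableOn_grad.smul_measure (c := ρ univ) (by simp [hρ1]))).prod_right_ae
  filter_upwards [h.ae_slice (by simp [hρ1]) hΨ, ae_restrict_of_ae hZr, hGi] with x hx hxZ hxG
  have hnorm : ∀ t, ‖Ψ (x, t)‖ = ‖x‖ := fun t => hab.norm_planeRotation t x
  have hnnorm : ∀ t, ‖Ψ (x, t)‖₊ = ‖x‖₊ := fun t => NNReal.eq (hnorm t)
  have hsl : Measurable fun t => Ψ (x, t) := hΨm.comp measurable_prodMk_left
  set w : ℝ → ℝ := fun t => u (Ψ (x, t)) with hw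
  set k : ℝ → ℝ := fun t => inner ℝ (G (Ψ (x, t))) (planeGenerator a b (Ψ (x, t))) with hk
  have hki : IntegrableOn k (Ioc 0 1) := by
    refine (hxG.norm.const_mul (2 * ‖x‖)).mono (hKm.comp hsl).aestronglyMeasurable
      (ae_of_all _ fun t => ?_)
    have := hab.norm_planeGenerator_le (Ψ (x, t))
    rw [hnorm] at this
    calc _ ≤ ‖G (Ψ (x, t))‖ * ‖planeGenerator a b (Ψ (x, t))‖ := norm_inner_le_norm _ _
      _ ≤ ‖G (Ψ (x, t))‖ * (2 * ‖x‖) := by gcongr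
      _ = ‖2 * ‖x‖ * ‖G (Ψ (x, t))‖‖ := by
        rw [Real.norm_of_nonneg (by positivity), mul_comm]
  -- along the circle, `u` is a primitive of its tangential derivative `k`
  obtain ⟨c, hc⟩ := ae_eq_primitive_of_approx (w := w) (h := k)
      (hu.comp hsl).aestronglyMeasurable hki (fun ε hε => by
    -- the generator has norm at most `2 ‖x‖` along the circle; the summand `1` keeps `C` positive
    set C : ℝ≥0 := 1 + 2 * ‖x‖₊ with hC
    have hC0 : (C : ℝ≥0∞) ≠ 0 := by
      rw [ENNReal.coe_ne_zero]; positivity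
    obtain ⟨φ, hφ, hlt⟩ := hx (ε / C) (ENNReal.div_ne_zero.2 ⟨hε, ENNReal.coe_ne_top⟩)
    refine ⟨fun t => φ (Ψ (x, t)), fun t => inner ℝ (gradient φ (Ψ (x, t)))
      (planeGenerator a b (Ψ (x, t))), fun t => hφ.hasDerivAt_planeRotation hab x t,
      (hφ.continuous_inner_planeGenerator a b).comp (continuous_planeRotation_angle a b x), ?_⟩
    have b2 : ∫⁻ t in Ioc 0 1, ‖inner ℝ (gradient φ (Ψ (x, t))) (planeGenerator a b (Ψ (x, t))) -
        k t‖ₑ ≤ C * ∫⁻ t, ‖gradient φ (Ψ (x, t)) - G (Ψ (x, t))‖ₑ ∂ρ := by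
      rw [← lintegral_const_mul' _ _ ENNReal.coe_ne_top]
      refine lintegral_mono fun t => ?_
      rw [hk, ← inner_sub_left]
      refine (hab.enorm_inner_planeGenerator_le _ _).trans ?_
      rw [hnnorm]
      gcongr
      exact le_add_of_nonneg_left zero_le
    have b1 : ∫⁻ t in Ioc 0 1, ‖φ (Ψ (x, t)) - w t‖ₑ ≤
        C * ∫⁻ t, ‖φ (Ψ (x, t)) - u (Ψ (x, t))‖ₑ ∂ρ :=
      le_mul_of_one_le_left zero_le (ENNReal.one_le_coe_iff.2 (le_add_of_nonneg_right zero_le))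
    refine (add_le_add b1 b2).trans ?_
    rw [← mul_add]
    calc _ ≤ (C : ℝ≥0∞) * (ε / C) := by gcongr
      _ = ε := ENNReal.mul_div_cancel hC0 ENNReal.coe_ne_top)
  have := ae_deriv_eq_zero_of_mem_null hki hc hxZ
  refine measure_eq_zero_iff_ae_notMem.2 ?_
  filter_upwards [this] with t ht hmem
  refine hmem.2 (ht ?_)
  have := hmem.1
  rwa [hnorm] at this

/-- If the tangential derivatives `x i * G j - x j * G i` vanish then `G` is parallel to `x`. -/
lemma norm_sq_smul_eq_of_planeGenerator {x y : EuclideanSpace ℝ (Fin N)}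
    (h : ∀ i j, i ≠ j → inner ℝ y (planeGenerator (EuclideanSpace.single i (1 : ℝ))
      (EuclideanSpace.single j 1) x) = 0) :
    ‖x‖ ^ 2 • y = (inner ℝ y x : ℝ) • x := by
  have h' : ∀ i j, x i * y j = x j * y i := by
    intro i j
    by_cases hij : i = j
    · rw [hij]
    · have := h i j hij
      simp only [planeGenerator, inner_sub_right, inner_smul_right,
        EuclideanSpace.inner_single_left, EuclideanSpace.inner_single_right, map_one, one_mul,
        conj_trivial] at this
      linarith
  ext j
  rw [PiLp.smul_apply, PiLp.smul_apply, smul_eq_mul, smul_eq_mul, EuclideanSpace.real_norm_sq_eq,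
    PiLp.inner_apply, Finset.sum_mul, Finset.sum_mul]
  refine Finset.sum_congr rfl fun i _ => ?_
  simp only [RCLike.inner_apply, conj_trivial]
  linear_combination x i * h' i j

lemma isOrthonormalPair_single {i j : Fin N} (hij : i ≠ j) :
    IsOrthonormalPair (EuclideanSpace.single i (1 : ℝ)) (EuclideanSpace.single j 1) :=
  ⟨by simp, by simp, by simp [EuclideanSpace.inner_single_left, hij]⟩

/-- The gradient of `u` is radial almost everywhere on the set where `(‖x‖, u x)` lies in a given
null set of the plane. -/
lemma IsStrongLimit.ae_radial_of_mem_null (h : IsStrongLimit (Metric.ball 0 R) u G) (hN : N ≠ 0)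
    {Z : Set (ℝ × ℝ)} (hZ : volume Z = 0) :
    ∀ᵐ x ∂volume.restrict (Metric.ball (0 : EuclideanSpace ℝ (Fin N)) R),
      (‖x‖, u x) ∈ Z → ‖x‖ ^ 2 • G x = (inner ℝ (G x) x : ℝ) • x := by
  have : ∀ i j : Fin N, ∀ᵐ x ∂volume.restrict (Metric.ball (0 : EuclideanSpace ℝ (Fin N)) R),
      i ≠ j → (‖x‖, u x) ∈ Z → inner ℝ (G x) (planeGenerator (EuclideanSpace.single i (1 : ℝ))
        (EuclideanSpace.single j 1) x) = 0 := by
    intro i j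
    by_cases hij : i = j
    · exact ae_of_all _ fun x hne => absurd hij hne
    · filter_upwards [h.ae_inner_planeGenerator_eq_zero_of_mem_null hN
        (isOrthonormalPair_single hij) hZ] with x hx _ using hx
  filter_upwards [ae_all_iff.2 fun i => ae_all_iff.2 (this i)] with x hx hxZ
  exact norm_sq_smul_eq_of_planeGenerator fun i j hij => hx i j hij hxZ

lemma inner_planeGenerator_eq_zero_of_radial {x y : EuclideanSpace ℝ (Fin N)}
    (a b : EuclideanSpace ℝ (Fin N)) (h : ‖x‖ ^ 2 • y = (inner ℝ y x : ℝ) • x) :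
    inner ℝ y (planeGenerator a b x) = 0 := by
  by_cases hx : x = 0
  · simp [hx, planeGenerator]
  have hx2 : ‖x‖ ^ 2 ≠ 0 := by simpa using hx
  have h1 : inner ℝ x (planeGenerator a b x) = 0 := by
    simp only [planeGenerator, inner_sub_right, inner_smul_right]
    rw [real_inner_comm a x, real_inner_comm b x]
    ring
  have h2 : inner ℝ (‖x‖ ^ 2 • y) (planeGenerator a b x) = 0 := by
    rw [h, inner_smul_left, h1, mul_zero]
  rw [inner_smul_left] at h2
  simpa [hx] using h2

end Tangential

/-! ### Functions with radial gradient are radially symmetric -/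

section Radial

variable {N : ℕ} {R : ℝ} {u : EuclideanSpace ℝ (Fin N) → ℝ}
  {G : EuclideanSpace ℝ (Fin N) → EuclideanSpace ℝ (Fin N)}

/-- If the derivative of `u` along the circles in the planes parallel to `a` and `b` vanishes, then
`u` is invariant under the rotations in the plane of `a` and `b`. -/
lemma IsStrongLimit.ae_planeRotation_eq (h : IsStrongLimit (Metric.ball 0 R) u G)
    {a b : EuclideanSpace ℝ (Fin N)} (hab : IsOrthonormalPair a b)
    (h0 : ∀ᵐ x ∂volume.restrict (Metric.ball (0 : EuclideanSpace ℝ (Fin N)) R),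
      inner ℝ (G x) (planeGenerator a b x) = 0) (t : ℝ) :
    ∀ᵐ x ∂volume.restrict (Metric.ball (0 : EuclideanSpace ℝ (Fin N)) R),
      u (planeRotation a b t x) = u x := by
  set B := Metric.ball (0 : EuclideanSpace ℝ (Fin N)) R with hB
  have hT := hab.measurePreserving_planeRotation_ball R t
  set ν : Measure ℝ := volume.restrict (uIoc 0 t) with hν
  have hνfin : ν univ ≠ ⊤ := by simp [hν]
  have hΨ := hab.measurePreserving_planeRotation_prod R ν
  -- the test function replaces `u` at both `x` and its image; the rest is the integral over `[0, t]`
  -- of the derivative along the rotation, whose generator is bounded by `2 R`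
  set c : ℝ≥0∞ := 1 + 1 + ν univ * (2 * R.toNNReal : ℝ≥0) with hc
  have hcfin : c ≠ ⊤ := by
    simp only [hc]; finiteness
  have hum := h.integrableOn.1
  have huT : AEStronglyMeasurable (fun x => u (planeRotation a b t x)) (volume.restrict B) :=
    hum.comp_measurePreserving hT
  have key : ∀ ε : ℝ≥0∞, ε ≠ 0 → ∫⁻ x in B, ‖u (planeRotation a b t x) - u x‖ₑ ≤ c * ε := by
    intro ε hε
    obtain ⟨φ, hφ, hle⟩ := h.approx ε hε
    set k : EuclideanSpace ℝ (Fin N) → ℝ :=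
      fun x => inner ℝ (gradient φ x) (planeGenerator a b x) with hk
    have hkc : Continuous k := hφ.continuous_inner_planeGenerator a b
    have hφm : AEMeasurable (fun x => ‖φ x - u x‖ₑ) (volume.restrict B) :=
      (hφ.continuous.aestronglyMeasurable.sub hum).enorm
    have hφTm : AEMeasurable (fun x => ‖φ (planeRotation a b t x) - u (planeRotation a b t x)‖ₑ)
        (volume.restrict B) := hφm.comp_quasiMeasurePreserving hT.quasiMeasurePreserving
    have e1 : ∫⁻ x in B, ‖φ (planeRotation a b t x) - u (planeRotation a b t x)‖ₑ =
        ∫⁻ x in B, ‖φ x - u x‖ₑ := by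
      rw [← hT.map_eq] at hφm
      conv_rhs => rw [← hT.map_eq, lintegral_map' hφm hT.aemeasurable]
    have e2 : ∫⁻ x in B, ∫⁻ s, ‖k (planeRotation a b s x)‖ₑ ∂ν = ν univ * ∫⁻ x in B, ‖k x‖ₑ := by
      rw [← smul_eq_mul, ← lintegral_smul_measure, ← hΨ.map_eq,
        lintegral_map hkc.measurable.enorm hΨ.measurable, lintegral_prod]
      exact (hkc.measurable.enorm.comp hΨ.measurable).aemeasurable
    have e3 : ∫⁻ x in B, ‖k x‖ₑ ≤
        (2 * R.toNNReal : ℝ≥0) * ∫⁻ x in B, ‖gradient φ x - G x‖ₑ := by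
      rw [← lintegral_const_mul' _ _ ENNReal.coe_ne_top]
      refine lintegral_mono_ae ?_
      filter_upwards [h0, ae_restrict_mem measurableSet_ball] with x hx hxB
      have : k x = inner ℝ (gradient φ x - G x) (planeGenerator a b x) := by
        rw [inner_sub_left, hx, sub_zero]
      rw [this]
      refine (hab.enorm_inner_planeGenerator_le _ _).trans ?_
      gcongr
      exact NNReal.le_toNNReal_of_coe_le (mem_ball_zero_iff.1 hxB).le
    have hpt : ∀ x, ‖u (planeRotation a b t x) - u x‖ₑ ≤ ‖φ x - u x‖ₑ +
        (‖φ (planeRotation a b t x) - u (planeRotation a b t x)‖ₑ +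
        ∫⁻ s, ‖k (planeRotation a b s x)‖ₑ ∂ν) := by
      intro x
      have hft : ∫ s in (0)..t, k (planeRotation a b s x) = φ (planeRotation a b t x) - φ x := by
        rw [intervalIntegral.integral_eq_sub_of_hasDerivAt
          (f := fun s => φ (planeRotation a b s x))
          (fun s _ => hφ.hasDerivAt_planeRotation hab x s)
          ((hkc.comp (continuous_planeRotation_angle a b x)).intervalIntegrable _ _),
          planeRotation_zero]
      have hle' : ‖φ (planeRotation a b t x) - φ x‖ₑ ≤
          ∫⁻ s, ‖k (planeRotation a b s x)‖ₑ ∂ν := by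
        rw [← hft]
        refine le_trans ?_ (enorm_integral_le_lintegral_enorm _)
        rw [← ofReal_norm, ← ofReal_norm, intervalIntegral.norm_intervalIntegral_eq]
      have : u (planeRotation a b t x) - u x = (φ x - u x) +
          (-(φ (planeRotation a b t x) - u (planeRotation a b t x)) +
          (φ (planeRotation a b t x) - φ x)) := by ring
      rw [this]
      refine (enorm_add_le _ _).trans ?_
      gcongr
      refine (enorm_add_le _ _).trans ?_
      rw [enorm_neg]
      gcongr
    refine (lintegral_mono hpt).trans ?_
    rw [lintegral_add_left' hφm, lintegral_add_left' hφTm, e1, e2]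
    have l1 : ∫⁻ x in B, ‖φ x - u x‖ₑ ≤ ε := le_self_add.trans hle
    have l2 : ∫⁻ x in B, ‖gradient φ x - G x‖ₑ ≤ ε := le_add_self.trans hle
    calc _ ≤ ε + (ε + ν univ * ((2 * R.toNNReal : ℝ≥0) * ε)) := by
          gcongr
          exact e3.trans (by gcongr)
      _ = c * ε := by simp only [hc]; ring
  have hzero : ∫⁻ x in B, ‖u (planeRotation a b t x) - u x‖ₑ = 0 := by
    have hlim : Tendsto (fun n : ℕ => c * (n : ℝ≥0∞)⁻¹) atTop (𝓝 (c * 0)) :=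
      ENNReal.Tendsto.const_mul ENNReal.tendsto_inv_nat_nhds_zero (.inr hcfin)
    rw [mul_zero] at hlim
    exact le_antisymm (ge_of_tendsto' hlim fun n => key _ (by simp)) zero_le
  have hdm : AEMeasurable (fun x => ‖u (planeRotation a b t x) - u x‖ₑ) (volume.restrict B) :=
    (huT.sub hum).enorm
  filter_upwards [(lintegral_eq_zero_iff' hdm).1 hzero] with x hx
  exact sub_eq_zero.1 (enorm_eq_zero.1 hx)

/-- Averages over balls inherit the invariance of a function under a rotation, at every point. -/
lemma IsOrthonormalPair.average_closedBall_planeRotation {a b : EuclideanSpace ℝ (Fin N)}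
    (hab : IsOrthonormalPair a b) {t : ℝ} {v : EuclideanSpace ℝ (Fin N) → ℝ}
    (hv : ∀ᵐ x, v (planeRotation a b t x) = v x) (x : EuclideanSpace ℝ (Fin N)) (r : ℝ) :
    ⨍ y in Metric.closedBall (planeRotation a b t x) r, v y =
      ⨍ y in Metric.closedBall x r, v y := by
  set T := (hab.rotation t).toLinearIsometryEquiv rfl with hTdef
  have hT : ∀ y, T y = planeRotation a b t y := fun y => rfl
  have himg : T ⁻¹' Metric.closedBall (T x) r = Metric.closedBall x r :=
    T.isometry.preimage_closedBall x r
  rw [← hT, setAverage_eq, setAverage_eq, ← himg, measureReal_def, measureReal_def,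
    T.measurePreserving.measure_preimage measurableSet_closedBall.nullMeasurableSet,
    ← T.measurePreserving.setIntegral_preimage_emb T.toHomeomorph.measurableEmbedding]
  congr 1
  exact setIntegral_congr_ae (measurableSet_closedBall.preimage T.continuous.measurable)
    (hv.mono fun y hy _ => hy)

/-- A `W^{1,1}_0` function with radial gradient is radially symmetric. -/
lemma IsStrongLimit.isRadiallySymmetric (hN : 2 ≤ N) (h : IsStrongLimit (Metric.ball 0 R) u G)
    (hrad : ∀ᵐ x ∂volume.restrict (Metric.ball (0 : EuclideanSpace ℝ (Fin N)) R),
      ‖x‖ ^ 2 • G x = (inner ℝ (G x) x : ℝ) • x) : IsRadiallySymmetric R u := by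
  set B := Metric.ball (0 : EuclideanSpace ℝ (Fin N)) R with hB
  set v : EuclideanSpace ℝ (Fin N) → ℝ := B.indicator u with hv
  have hvi : Integrable v := (integrable_indicator_iff measurableSet_ball).2 h.integrableOn
  have hinv : ∀ {a b : EuclideanSpace ℝ (Fin N)}, IsOrthonormalPair a b → ∀ t : ℝ,
      ∀ᵐ x, v (planeRotation a b t x) = v x := by
    intro a b hab t
    have h1 := h.ae_planeRotation_eq hab
      (hrad.mono fun x hx => inner_planeGenerator_eq_zero_of_radial a b hx) t
    rw [ae_restrict_iff' measurableSet_ball] at h1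
    filter_upwards [h1] with x hx
    have hmem : planeRotation a b t x ∈ B ↔ x ∈ B := by
      simp only [hB, mem_ball_zero_iff, hab.norm_planeRotation]
    by_cases hxB : x ∈ B
    · rw [hv, indicator_of_mem hxB, indicator_of_mem (hmem.2 hxB), hx hxB]
    · rw [hv, indicator_of_notMem hxB, indicator_of_notMem (fun hh => hxB (hmem.1 hh))]
  set e : EuclideanSpace ℝ (Fin N) := EuclideanSpace.single ⟨0, by omega⟩ 1 with he
  have he1 : ‖e‖ = 1 := by simp [he]
  set A : ℕ → EuclideanSpace ℝ (Fin N) → ℝ := fun n x =>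
    ⨍ y in Metric.closedBall x (1 / ((n : ℝ) + 1)), v y with hA
  have hArad : ∀ n x, A n x = A n (‖x‖ • e) := by
    intro n x
    obtain ⟨b, t, hab, hx⟩ := IsOrthonormalPair.exists_planeRotation_eq
      (by simpa using hN) he1 x
    have := hab.average_closedBall_planeRotation (hinv hab t) (‖x‖ • e) (1 / ((n : ℝ) + 1))
    rw [hx] at this
    exact this
  -- by Lebesgue's differentiation theorem the averages, which are functions of `‖x‖`, tend to `u`
  refine ⟨fun r => limUnder atTop fun n => A n (r • e), ?_⟩
  have hLeb := IsUnifLocDoublingMeasure.ae_tendsto_average volume hvi.locallyIntegrable 1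
  filter_upwards [ae_restrict_of_ae hLeb, ae_restrict_mem measurableSet_ball] with x hx hxB
  have hδ : Tendsto (fun n : ℕ => 1 / ((n : ℝ) + 1)) atTop (𝓝[>] 0) :=
    tendsto_nhdsWithin_iff.2 ⟨tendsto_one_div_add_atTop_nhds_zero_nat,
      .of_forall fun n => mem_Ioi.2 (by positivity)⟩
  have hlim : Tendsto (fun n => A n x) atTop (𝓝 (v x)) :=
    hx (fun _ => x) _ hδ (.of_forall fun n => Metric.mem_closedBall_self (by positivity))
  simp_rw [hArad _ x] at hlim
  rw [hlim.limUnder_eq, hv, indicator_of_mem hxB]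

end Radial

/-! ### Integrals of extended-real-valued functions -/

section ERealIntegral

lemma erealIntegral_congr_ae {α : Type*} [MeasurableSpace α] {μ : Measure α} {h k : α → EReal}
    (hk : h =ᵐ[μ] k) : erealIntegral μ h = erealIntegral μ k := by
  have h1 : ∫⁻ x, (h x).toENNReal ∂μ = ∫⁻ x, (k x).toENNReal ∂μ :=
    lintegral_congr_ae (hk.mono fun x hx => by simp only [hx])
  have h2 : ∫⁻ x, (-h x).toENNReal ∂μ = ∫⁻ x, (-k x).toENNReal ∂μ :=
    lintegral_congr_ae (hk.mono fun x hx => by simp only [hx])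
  rw [erealIntegral, erealIntegral, h1, h2]

lemma EReal.eq_of_toENNReal_eq {a b : EReal} (h : a.toENNReal = b.toENNReal)
    (h' : (-a).toENNReal = (-b).toENNReal) : a = b := by
  have key : ∀ c : EReal, c = (c.toENNReal : EReal) - ((-c).toENNReal : EReal) := fun c => by
    rcases le_total 0 c with hc | hc
    · rw [EReal.toENNReal_of_nonpos (x := -c) (by simpa using hc), EReal.coe_toENNReal hc]
      simp
    · rw [EReal.toENNReal_of_nonpos hc, EReal.coe_toENNReal (by simpa using hc)]
      simp
  rw [key a, key b, h, h']

lemma ENNReal.add_le_add_of_ereal_sub_le {a b c d : ℝ≥0∞} (ha : a ≠ ⊤) (hb : b ≠ ⊤) (hc : c ≠ ⊤)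
    (h : (a : EReal) - b ≤ c - d) : a + d ≤ c + b := by
  lift a to ℝ≥0 using ha
  lift b to ℝ≥0 using hb
  lift c to ℝ≥0 using hc
  have h2 : ∀ a b : ℝ≥0, ((a : ℝ≥0∞) : EReal) - ((b : ℝ≥0∞) : EReal) = ((a - b : ℝ) : EReal) := by
    intro a b; push_cast; rfl
  by_cases hd : d = ⊤
  · rw [hd, h2, EReal.coe_ennreal_top, EReal.sub_top, le_bot_iff] at h
    exact absurd h (EReal.coe_ne_bot _)
  lift d to ℝ≥0 using hd
  rw [h2, h2, EReal.coe_le_coe_iff] at h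
  have : a + d ≤ c + b := by
    rw [← NNReal.coe_le_coe]; push_cast; linarith
  exact_mod_cast this

lemma ENNReal.add_lt_add_of_ereal_sub_lt {a b c d : ℝ≥0∞} (ha : a ≠ ⊤) (hb : b ≠ ⊤) (hc : c ≠ ⊤)
    (h : (a : EReal) - b < c - d) : a + d < c + b := by
  lift a to ℝ≥0 using ha
  lift b to ℝ≥0 using hb
  lift c to ℝ≥0 using hc
  by_cases hd : d = ⊤
  · simp [hd] at h
  lift d to ℝ≥0 using hd
  have h2 : ∀ a b : ℝ≥0, ((a : ℝ≥0∞) : EReal) - ((b : ℝ≥0∞) : EReal) = ((a - b : ℝ) : EReal) := by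
    intro a b; push_cast; rfl
  rw [h2, h2, EReal.coe_lt_coe_iff] at h
  have : a + d < c + b := by
    rw [← NNReal.coe_lt_coe]; push_cast; linarith
  exact_mod_cast this

end ERealIntegral

/-! ### Comparison of an integral with its restrictions to rays -/

section Comparison

variable {E : Type*} [NormedAddCommGroup E] [NormedSpace ℝ E] [MeasurableSpace E] [BorelSpace E]
  [FiniteDimensional ℝ E] [Nontrivial E] {μ : Measure E} [μ.IsAddHaarMeasure] {R : ℝ}
  {h H : E → EReal}

lemma erealIntegral_of_ne_top {α : Type*} [MeasurableSpace α] {μ : Measure α} {h : α → EReal}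
    (hfin : ∫⁻ x, (h x).toENNReal ∂μ ≠ ⊤) :
    erealIntegral μ h = ((∫⁻ x, (h x).toENNReal ∂μ : ℝ≥0∞) : EReal) -
      ((∫⁻ x, (-h x).toENNReal ∂μ : ℝ≥0∞) : EReal) := by
  rw [erealIntegral, if_neg hfin]

lemma lintegral_toENNReal_le_of_ae_le {α : Type*} [MeasurableSpace α] {μ : Measure α}
    {h H : α → EReal} (hle : ∀ᵐ x ∂μ, h x ≤ H x) :
    ∫⁻ x, (h x).toENNReal ∂μ ≤ ∫⁻ x, (H x).toENNReal ∂μ ∧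
      ∫⁻ x, (-H x).toENNReal ∂μ ≤ ∫⁻ x, (-h x).toENNReal ∂μ :=
  ⟨lintegral_mono_ae (hle.mono fun _ hx => EReal.toENNReal_le_toENNReal hx),
    lintegral_mono_ae (hle.mono fun _ hx =>
      EReal.toENNReal_le_toENNReal (EReal.neg_le_neg_iff.2 hx))⟩

lemma ae_lintegral_ray_ne_top {k : E → ℝ≥0∞} (hk : AEMeasurable k (μ.restrict (Metric.ball 0 R)))
    (hfin : ∫⁻ x in Metric.ball 0 R, k x ∂μ ≠ ⊤) :
    ∀ᵐ e ∂μ.toSphere, ∫⁻ x in Metric.ball 0 R, k (‖x‖ • e.1) ∂μ ≠ ⊤ := by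
  refine (ae_lt_top' (aemeasurable_lintegral_ball_rayMap μ hk) ?_).mono fun e he => he.ne
  rw [lintegral_toSphere_lintegral_ball μ hk]
  exact ENNReal.mul_ne_top (measure_ne_top _ _) hfin

/-- If `h ≤ H` and the integral of `H` is finite, then some ray extension of `h` has at most the
integral of `H`, because the mean over all rays is the integral of `h`. -/
lemma exists_erealIntegral_ray_le (hh : AEMeasurable h (μ.restrict (Metric.ball 0 R)))
    (hle : ∀ᵐ x ∂μ.restrict (Metric.ball 0 R), h x ≤ H x)
    (hpos : ∫⁻ x in Metric.ball 0 R, (H x).toENNReal ∂μ ≠ ⊤)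
    (hneg : ∫⁻ x in Metric.ball 0 R, (-H x).toENNReal ∂μ ≠ ⊤)
    {p : Metric.sphere (0 : E) 1 → Prop} (hp : ∀ᵐ e ∂μ.toSphere, p e) :
    ∃ e, p e ∧ erealIntegral (μ.restrict (Metric.ball 0 R)) (fun x => h (‖x‖ • e.1)) ≤
      erealIntegral (μ.restrict (Metric.ball 0 R)) H := by
  have hpm : AEMeasurable (fun x => (h x).toENNReal) (μ.restrict (Metric.ball 0 R)) :=
    measurable_ereal_toENNReal.comp_aemeasurable hh
  have hnm : AEMeasurable (fun x => (-h x).toENNReal) (μ.restrict (Metric.ball 0 R)) :=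
    measurable_ereal_toENNReal.comp_aemeasurable hh.neg
  obtain ⟨hlep, hlen⟩ := lintegral_toENNReal_le_of_ae_le hle
  by_contra! hcon
  have hlt : ∀ᵐ e ∂μ.toSphere,
      (∫⁻ x in Metric.ball 0 R, (H x).toENNReal ∂μ) +
        ∫⁻ x in Metric.ball 0 R, (-h (‖x‖ • e.1)).toENNReal ∂μ <
      (∫⁻ x in Metric.ball 0 R, (h (‖x‖ • e.1)).toENNReal ∂μ) +
        ∫⁻ x in Metric.ball 0 R, (-H x).toENNReal ∂μ := by
    filter_upwards [hp, ae_lintegral_ray_ne_top hpm (ne_top_of_le_ne_top hpos hlep)] with e he hfin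
    have := hcon e he
    rw [erealIntegral_of_ne_top hpos, erealIntegral_of_ne_top hfin] at this
    exact ENNReal.add_lt_add_of_ereal_sub_lt hpos hneg hfin this
  have hR : ∫⁻ e, ((∫⁻ x in Metric.ball 0 R, (h (‖x‖ • e.1)).toENNReal ∂μ) +
      ∫⁻ x in Metric.ball 0 R, (-H x).toENNReal ∂μ) ∂μ.toSphere = μ.toSphere univ *
      ((∫⁻ x in Metric.ball 0 R, (h x).toENNReal ∂μ) +
        ∫⁻ x in Metric.ball 0 R, (-H x).toENNReal ∂μ) := by
    rw [lintegral_add_right _ measurable_const, lintegral_toSphere_lintegral_ball μ hpm,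
      lintegral_const]
    ring
  have hL : ∫⁻ e, ((∫⁻ x in Metric.ball 0 R, (H x).toENNReal ∂μ) +
      ∫⁻ x in Metric.ball 0 R, (-h (‖x‖ • e.1)).toENNReal ∂μ) ∂μ.toSphere = μ.toSphere univ *
      ((∫⁻ x in Metric.ball 0 R, (H x).toENNReal ∂μ) +
        ∫⁻ x in Metric.ball 0 R, (-h x).toENNReal ∂μ) := by
    rw [lintegral_add_left measurable_const, lintegral_toSphere_lintegral_ball μ hnm,
      lintegral_const]
    ring
  -- the strict inequality between the integrands integrates strictly because the larger integral is
  -- finite; this contradicts the comparison of positive and negative parts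
  have hRfin : μ.toSphere univ * ((∫⁻ x in Metric.ball 0 R, (h x).toENNReal ∂μ) +
      ∫⁻ x in Metric.ball 0 R, (-H x).toENNReal ∂μ) ≠ ⊤ :=
    ENNReal.mul_ne_top (measure_ne_top _ _)
      (ENNReal.add_ne_top.2 ⟨ne_top_of_le_ne_top hpos hlep, hneg⟩)
  have := lintegral_strict_mono (μ.toSphere_ne_zero)
    ((aemeasurable_lintegral_ball_rayMap μ hpm).add aemeasurable_const)
    (ne_top_of_le_ne_top (hR ▸ hRfin) (lintegral_mono_ae (hlt.mono fun _ h => h.le))) hlt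
  simp only [Pi.add_apply] at this
  rw [hL, hR] at this
  exact this.not_ge (by gcongr)

/-- If `h ≤ H`, the integral of `H` is finite, and almost no ray extension of `h` has a smaller
integral than `H`, then `h = H` almost everywhere. -/
lemma ae_eq_of_erealIntegral_le_ray (hh : AEMeasurable h (μ.restrict (Metric.ball 0 R)))
    (hH : AEMeasurable H (μ.restrict (Metric.ball 0 R)))
    (hle : ∀ᵐ x ∂μ.restrict (Metric.ball 0 R), h x ≤ H x)
    (hpos : ∫⁻ x in Metric.ball 0 R, (H x).toENNReal ∂μ ≠ ⊤)
    (hneg : ∫⁻ x in Metric.ball 0 R, (-H x).toENNReal ∂μ ≠ ⊤)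
    (hray : ∀ᵐ e ∂μ.toSphere, erealIntegral (μ.restrict (Metric.ball 0 R)) H ≤
      erealIntegral (μ.restrict (Metric.ball 0 R)) (fun x => h (‖x‖ • e.1))) :
    h =ᵐ[μ.restrict (Metric.ball 0 R)] H := by
  have hpm : AEMeasurable (fun x => (h x).toENNReal) (μ.restrict (Metric.ball 0 R)) :=
    measurable_ereal_toENNReal.comp_aemeasurable hh
  have hnm : AEMeasurable (fun x => (-h x).toENNReal) (μ.restrict (Metric.ball 0 R)) :=
    measurable_ereal_toENNReal.comp_aemeasurable hh.neg
  have hpM : AEMeasurable (fun x => (H x).toENNReal) (μ.restrict (Metric.ball 0 R)) :=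
    measurable_ereal_toENNReal.comp_aemeasurable hH
  obtain ⟨hlep, hlen⟩ := lintegral_toENNReal_le_of_ae_le hle
  have hpfin := ne_top_of_le_ne_top hpos hlep
  have hle' : (∫⁻ x in Metric.ball 0 R, (H x).toENNReal ∂μ) +
      ∫⁻ x in Metric.ball 0 R, (-h x).toENNReal ∂μ ≤
      (∫⁻ x in Metric.ball 0 R, (h x).toENNReal ∂μ) +
        ∫⁻ x in Metric.ball 0 R, (-H x).toENNReal ∂μ := by
    have hae : ∀ᵐ e ∂μ.toSphere,
        (∫⁻ x in Metric.ball 0 R, (H x).toENNReal ∂μ) +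
          ∫⁻ x in Metric.ball 0 R, (-h (‖x‖ • e.1)).toENNReal ∂μ ≤
        (∫⁻ x in Metric.ball 0 R, (h (‖x‖ • e.1)).toENNReal ∂μ) +
          ∫⁻ x in Metric.ball 0 R, (-H x).toENNReal ∂μ := by
      filter_upwards [hray, ae_lintegral_ray_ne_top hpm hpfin] with e he hfin
      rw [erealIntegral_of_ne_top hpos, erealIntegral_of_ne_top hfin] at he
      exact ENNReal.add_le_add_of_ereal_sub_le hpos hneg hfin he
    have := lintegral_mono_ae hae
    rw [lintegral_add_right _ measurable_const, lintegral_add_left measurable_const,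
      lintegral_toSphere_lintegral_ball μ hpm, lintegral_toSphere_lintegral_ball μ hnm,
      lintegral_const, lintegral_const, mul_comm _ (μ.toSphere univ),
      mul_comm _ (μ.toSphere univ), ← mul_add, ← mul_add] at this
    exact (ENNReal.mul_le_mul_iff_right (Measure.measure_univ_ne_zero.2 μ.toSphere_ne_zero)
      (measure_ne_top _ _)).1 this
  have hp' : ∫⁻ x in Metric.ball 0 R, (H x).toENNReal ∂μ ≤
      ∫⁻ x in Metric.ball 0 R, (h x).toENNReal ∂μ :=
    (ENNReal.add_le_add_iff_right hneg).1 ((add_le_add_right hlen _).trans hle')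
  have hn' : ∫⁻ x in Metric.ball 0 R, (-h x).toENNReal ∂μ ≤
      ∫⁻ x in Metric.ball 0 R, (-H x).toENNReal ∂μ :=
    (ENNReal.add_le_add_iff_left hpos).1 (hle'.trans (add_le_add_left hlep _))
  have e1 := ae_eq_of_ae_le_of_lintegral_le
    (hle.mono fun _ hx => EReal.toENNReal_le_toENNReal hx) hpfin hpM hp'
  have e2 := ae_eq_of_ae_le_of_lintegral_le
    (hle.mono fun _ hx => EReal.toENNReal_le_toENNReal (EReal.neg_le_neg_iff.2 hx)) hneg hnm hn'
  filter_upwards [e1, e2] with x h1 h2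
  exact EReal.eq_of_toENNReal_eq h1 h2.symm

end Comparison

/-! ### Symmetrization of the energy -/

section Energy

variable {N : ℕ} {R : ℝ} {f : ℝ → ℝ → ℝ≥0 → EReal} {u : EuclideanSpace ℝ (Fin N) → ℝ}
  {G : EuclideanSpace ℝ (Fin N) → EuclideanSpace ℝ (Fin N)}

/-- The derivative in the radial direction of a function with gradient `G`. -/
noncomputable def radialDerivative (G : EuclideanSpace ℝ (Fin N) → EuclideanSpace ℝ (Fin N))
    (x : EuclideanSpace ℝ (Fin N)) : ℝ := inner ℝ (G x) (‖x‖⁻¹ • x)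

lemma nnnorm_radialDerivative_le (G : EuclideanSpace ℝ (Fin N) → EuclideanSpace ℝ (Fin N))
    {x : EuclideanSpace ℝ (Fin N)} (hx : x ≠ 0) : ‖radialDerivative G x‖₊ ≤ ‖G x‖₊ := by
  have h := norm_inner_le_norm (𝕜 := ℝ) (G x) (‖x‖⁻¹ • x)
  rwa [norm_smul, norm_inv, norm_norm, inv_mul_cancel₀ (norm_ne_zero_iff.2 hx), mul_one] at h

lemma norm_sq_mul_radialDerivative_sq (G : EuclideanSpace ℝ (Fin N) → EuclideanSpace ℝ (Fin N))
    {x : EuclideanSpace ℝ (Fin N)} (hx : x ≠ 0) :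
    ‖x‖ ^ 2 * radialDerivative G x ^ 2 = (inner ℝ (G x) x : ℝ) ^ 2 := by
  have := norm_ne_zero_iff.2 hx
  rw [radialDerivative, inner_smul_right]
  field_simp

/-- The radial derivative has the length of the gradient exactly when the gradient is radial. -/
lemma nnnorm_radialDerivative_eq_iff (G : EuclideanSpace ℝ (Fin N) → EuclideanSpace ℝ (Fin N))
    {x : EuclideanSpace ℝ (Fin N)} (hx : x ≠ 0) :
    ‖radialDerivative G x‖₊ = ‖G x‖₊ ↔ ‖x‖ ^ 2 • G x = (inner ℝ (G x) x : ℝ) • x := by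
  have hx' := norm_ne_zero_iff.2 hx
  have h1 := norm_sq_mul_radialDerivative_sq G hx
  have h2 : ‖‖x‖ ^ 2 • G x - (inner ℝ (G x) x : ℝ) • x‖ ^ 2 =
      ‖x‖ ^ 4 * (‖G x‖ ^ 2 - radialDerivative G x ^ 2) := by
    rw [@norm_sub_sq_real, norm_smul, norm_smul, inner_smul_left, inner_smul_right, mul_pow,
      mul_pow, Real.norm_eq_abs, Real.norm_eq_abs, sq_abs, sq_abs, conj_trivial]
    linear_combination (‖x‖ ^ 2) * h1
  rw [← sub_eq_zero (a := ‖x‖ ^ 2 • G x), ← norm_eq_zero, ← sq_eq_zero_iff, h2, mul_eq_zero,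
    or_iff_right (by positivity), sub_eq_zero, ← NNReal.coe_inj, coe_nnnorm, coe_nnnorm,
    ← sq_eq_sq₀ (norm_nonneg _) (norm_nonneg _), Real.norm_eq_abs, sq_abs]
  exact eq_comm

/-- For a normal integrand `f`, the superposition `x ↦ f(‖x‖, u(x), s(x))` is measurable. -/
lemma IsNormalIntegrand.aemeasurable_comp (hN : N ≠ 0) (hf : IsNormalIntegrand R f)
    (hu : AEMeasurable u (volume.restrict (Metric.ball 0 R)))
    {s : EuclideanSpace ℝ (Fin N) → ℝ≥0}
    (hs : AEMeasurable s (volume.restrict (Metric.ball 0 R))) :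
    AEMeasurable (fun x => f ‖x‖ (u x) (s x)) (volume.restrict (Metric.ball 0 R)) := by
  have : NeZero N := ⟨hN⟩
  obtain ⟨-, -, g, -, hg, hgf⟩ := hf
  rw [ae_restrict_iff' measurableSet_Icc] at hgf
  have h1 : AEMeasurable (fun x => g ‖x‖ (u x) (s x)) (volume.restrict (Metric.ball 0 R)) :=
    hg.comp_aemeasurable (measurable_norm.aemeasurable.prodMk (hu.prodMk hs))
  refine h1.congr ?_
  filter_upwards [ae_restrict_of_ae (ae_norm_of_ae volume hgf), ae_restrict_mem measurableSet_ball]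
    with x hx hxB
  rw [hx ⟨norm_nonneg x, (mem_ball_zero_iff.1 hxB).le⟩]

lemma IsStrongLimit.energy_eq (h : IsStrongLimit (Metric.ball 0 R) u G) :
    energy R f u = erealIntegral (volume.restrict (Metric.ball 0 R))
      fun x => f ‖x‖ (u x) ‖G x‖₊ :=
  erealIntegral_congr_ae ((h.weakGradient_ae_eq Metric.isOpen_ball).mono fun x hx => by
    simp only [hx])

/-- The energy of a ray extension is the integral along the ray of the integrand in which the
gradient of `u` is replaced by its radial derivative. -/
lemma IsStrongLimit.energy_rayExtension (hN : N ≠ 0) {e : EuclideanSpace ℝ (Fin N)} (he : ‖e‖ = 1)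
    (h : IsStrongLimit (Metric.ball 0 R) (rayExtension u e) (rayGradient G e)) :
    energy R f (rayExtension u e) = erealIntegral (volume.restrict (Metric.ball 0 R))
      fun x : EuclideanSpace ℝ (Fin N) =>
        f ‖‖x‖ • e‖ (u (‖x‖ • e)) ‖radialDerivative G (‖x‖ • e)‖₊ := by
  have : NeZero N := ⟨hN⟩
  rw [h.energy_eq]
  refine erealIntegral_congr_ae ?_
  have h0 : ∀ᵐ x ∂volume.restrict (Metric.ball (0 : EuclideanSpace ℝ (Fin N)) R), x ≠ 0 :=
    ae_restrict_of_ae (by simp [ae_iff])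
  filter_upwards [h0] with x hx
  have hn : ‖‖x‖ • e‖ = ‖x‖ := by rw [norm_smul, he, mul_one, norm_norm]
  have hr : ‖rayGradient G e x‖₊ = ‖radialDerivative G (‖x‖ • e)‖₊ := by
    refine NNReal.eq ?_
    rw [coe_nnnorm, coe_nnnorm, norm_rayGradient G e hx, radialDerivative, hn, smul_smul,
      inv_mul_cancel₀ (norm_ne_zero_iff.2 hx), one_smul, Real.norm_eq_abs]
  rw [hr, hn]
  rfl

lemma isRadiallySymmetric_rayExtension (u : EuclideanSpace ℝ (Fin N) → ℝ)
    (e : EuclideanSpace ℝ (Fin N)) : IsRadiallySymmetric R (rayExtension u e) :=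
  ⟨fun r => u (r • e), ae_of_all _ fun _ => rfl⟩

lemma isRadiallySymmetric_zero :
    IsRadiallySymmetric R (0 : EuclideanSpace ℝ (Fin N) → ℝ) :=
  ⟨0, ae_of_all _ fun _ => rfl⟩

/-- A property of `(r, t)` which holds almost everywhere holds at `(‖x‖, u x)` at almost every point
where the gradient of `u` is not radial. -/
lemma IsStrongLimit.ae_of_ae_or_radial (h : IsStrongLimit (Metric.ball 0 R) u G) (hN : N ≠ 0)
    {p : ℝ × ℝ → Prop} (hp : ∀ᵐ q : ℝ × ℝ ∂volume.restrict (Icc 0 R ×ˢ univ), p q) :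
    ∀ᵐ x ∂volume.restrict (Metric.ball (0 : EuclideanSpace ℝ (Fin N)) R),
      p (‖x‖, u x) ∨ ‖x‖ ^ 2 • G x = (inner ℝ (G x) x : ℝ) • x := by
  rw [ae_restrict_iff' (measurableSet_Icc.prod MeasurableSet.univ), ae_iff] at hp
  filter_upwards [h.ae_radial_of_mem_null hN hp, ae_restrict_mem measurableSet_ball] with x hx hxB
  by_cases hpx : p (‖x‖, u x)
  · exact .inl hpx
  · exact .inr (hx fun hh =>
      hpx (hh ⟨⟨norm_nonneg x, (mem_ball_zero_iff.1 hxB).le⟩, mem_univ _⟩))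

/-- Replacing the gradient by the radial derivative decreases the integrand almost everywhere. -/
lemma IsStrongLimit.ae_integrand_radialDerivative_le (h : IsStrongLimit (Metric.ball 0 R) u G)
    (hN : N ≠ 0)
    (hmono : ∀ᵐ p : ℝ × ℝ ∂(volume.restrict (Icc 0 R ×ˢ univ)), Monotone (f p.1 p.2)) :
    ∀ᵐ x ∂volume.restrict (Metric.ball (0 : EuclideanSpace ℝ (Fin N)) R),
      f ‖x‖ (u x) ‖radialDerivative G x‖₊ ≤ f ‖x‖ (u x) ‖G x‖₊ := by
  have : NeZero N := ⟨hN⟩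
  have h0 : ∀ᵐ x ∂volume.restrict (Metric.ball (0 : EuclideanSpace ℝ (Fin N)) R), x ≠ 0 :=
    ae_restrict_of_ae (by simp [ae_iff])
  filter_upwards [h.ae_of_ae_or_radial hN hmono, h0] with x hx hx0
  rcases hx with hx | hx
  · exact hx (nnnorm_radialDerivative_le G hx0)
  · rw [(nnnorm_radialDerivative_eq_iff G hx0).2 hx]

lemma IsStrongLimit.aemeasurable_integrand (h : IsStrongLimit (Metric.ball 0 R) u G) (hN : N ≠ 0)
    (hf : IsNormalIntegrand R f) :
    AEMeasurable (fun x => f ‖x‖ (u x) ‖G x‖₊) (volume.restrict (Metric.ball 0 R)) :=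
  hf.aemeasurable_comp hN h.integrableOn.1.aemeasurable h.integrableOn_grad.1.aemeasurable.nnnorm

lemma IsStrongLimit.aemeasurable_integrand_radialDerivative
    (h : IsStrongLimit (Metric.ball 0 R) u G) (hN : N ≠ 0) (hf : IsNormalIntegrand R f) :
    AEMeasurable (fun x => f ‖x‖ (u x) ‖radialDerivative G x‖₊)
      (volume.restrict (Metric.ball 0 R)) := by
  refine hf.aemeasurable_comp hN h.integrableOn.1.aemeasurable (AEMeasurable.nnnorm ?_)
  have hm : Measurable fun x : EuclideanSpace ℝ (Fin N) => ‖x‖⁻¹ • x := by fun_prop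
  exact h.integrableOn_grad.1.aemeasurable.inner hm.aemeasurable

/-- An integral which is neither `-∞` nor `+∞` has finite positive and negative parts. -/
lemma erealIntegral_ne_top_ne_bot {α : Type*} [MeasurableSpace α] {μ : Measure α} {h : α → EReal}
    (htop : erealIntegral μ h ≠ ⊤) (hbot : erealIntegral μ h ≠ ⊥) :
    ∫⁻ x, (h x).toENNReal ∂μ ≠ ⊤ ∧ ∫⁻ x, (-h x).toENNReal ∂μ ≠ ⊤ := by
  have h1 : ∫⁻ x, (h x).toENNReal ∂μ ≠ ⊤ := fun h1 => htop (by rw [erealIntegral, if_pos h1])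
  refine ⟨h1, fun h2 => hbot ?_⟩
  rw [erealIntegral_of_ne_top h1, h2, EReal.coe_ennreal_top, EReal.sub_top]

/-- Some ray extension of `u` has at most the energy of `u`. It may have energy `-∞`, since the
negative part of the integrand may grow when the gradient is replaced by the radial derivative. -/
lemma exists_radiallySymmetric_energy_le (hN : N ≠ 0) (hf : IsNormalIntegrand R f)
    (hmono : ∀ᵐ p : ℝ × ℝ ∂(volume.restrict (Icc 0 R ×ˢ univ)), Monotone (f p.1 p.2))
    (hu : MemW11Zero (Metric.ball 0 R) u) (hbot : energy R f u ≠ ⊥) :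
    ∃ v : EuclideanSpace ℝ (Fin N) → ℝ, MemW11Zero (Metric.ball 0 R) v ∧
      IsRadiallySymmetric R v ∧ energy R f v ≤ energy R f u := by
  have : NeZero N := ⟨hN⟩
  -- a function of infinite energy is beaten by any radial function, such as zero
  by_cases htop : energy R f u = ⊤
  · exact ⟨0, IsStrongLimit.zero.memW11Zero Metric.isOpen_ball, isRadiallySymmetric_zero,
      htop ▸ le_top⟩
  have h := hu.isStrongLimit
  obtain ⟨hpos, hneg⟩ := erealIntegral_ne_top_ne_bot htop hbot
  obtain ⟨e, he, hle⟩ := exists_erealIntegral_ray_le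
    (h.aemeasurable_integrand_radialDerivative hN hf)
    (h.ae_integrand_radialDerivative_le hN hmono) hpos hneg (h.ae_rayExtension hN)
  exact ⟨rayExtension u e.1, he.memW11Zero Metric.isOpen_ball, isRadiallySymmetric_rayExtension _ _,
    (he.energy_rayExtension hN (by simp)).trans_le hle⟩

/-- Since almost no ray extension of a minimizer has less energy, strict monotonicity forces the
gradient of a minimizer to be radial. -/
lemma IsEnergyMinimizer.isRadiallySymmetric (hN : 2 ≤ N) (hf : IsNormalIntegrand R f)
    (hmono : ∀ᵐ p : ℝ × ℝ ∂(volume.restrict (Icc 0 R ×ˢ univ)), StrictMono (f p.1 p.2))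
    (hu : IsEnergyMinimizer R f u) : IsRadiallySymmetric R u := by
  have hN0 : N ≠ 0 := by omega
  have : NeZero N := ⟨hN0⟩
  obtain ⟨hmem, hbot, htop, hmin⟩ := hu
  have h := hmem.isStrongLimit
  obtain ⟨hpos, hneg⟩ := erealIntegral_ne_top_ne_bot htop hbot
  have heq := ae_eq_of_erealIntegral_le_ray (h.aemeasurable_integrand_radialDerivative hN0 hf)
    (h.aemeasurable_integrand hN0 hf)
    (h.ae_integrand_radialDerivative_le hN0 (hmono.mono fun _ hp => hp.monotone)) hpos hneg (by
      filter_upwards [h.ae_rayExtension hN0] with e he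
      exact (hmin _ (he.memW11Zero Metric.isOpen_ball)).trans_eq
        (he.energy_rayExtension hN0 (by simp)))
  have h0 : ∀ᵐ x ∂volume.restrict (Metric.ball (0 : EuclideanSpace ℝ (Fin N)) R), x ≠ 0 :=
    ae_restrict_of_ae (by simp [ae_iff])
  refine h.isRadiallySymmetric hN ?_
  filter_upwards [heq, h.ae_of_ae_or_radial hN0 hmono, h0] with x hx hx' hx0
  rcases hx' with hs | hr
  · exact (nnnorm_radialDerivative_eq_iff _ hx0).1 (hs.injective hx)
  · exact hr

end Energy

theorem mainTheorem1 (N : ℕ) (hN : 1 ≤ N) (R : ℝ) (hR : 0 < R) (f : ℝ → ℝ → ℝ≥0 → EReal)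
    (hf : IsNormalIntegrand R f)
    (hmono : ∀ᵐ p : ℝ × ℝ ∂(volume.restrict (Icc 0 R ×ˢ univ)), Monotone (f p.1 p.2)) :
    (∀ u : EuclideanSpace ℝ (Fin N) → ℝ, MemW11Zero (Metric.ball 0 R) u → energy R f u ≠ ⊥ →
      ∃ v : EuclideanSpace ℝ (Fin N) → ℝ, MemW11Zero (Metric.ball 0 R) v ∧
        IsRadiallySymmetric R v ∧ energy R f v ≤ energy R f u) ∧
    ((∃ u : EuclideanSpace ℝ (Fin N) → ℝ, IsEnergyMinimizer R f u) →
      ∃ v : EuclideanSpace ℝ (Fin N) → ℝ, IsEnergyMinimizer R f v ∧ IsRadiallySymmetric R v) ∧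
    (2 ≤ N →
      (∀ᵐ p : ℝ × ℝ ∂(volume.restrict (Icc 0 R ×ˢ univ)), StrictMono (f p.1 p.2)) →
      ∀ u : EuclideanSpace ℝ (Fin N) → ℝ, IsEnergyMinimizer R f u → IsRadiallySymmetric R u) := by
  have hN0 : N ≠ 0 := by omega
  refine ⟨fun u hu hbot => exists_radiallySymmetric_energy_le hN0 hf hmono hu hbot, ?_,
    fun hN2 hs u hu => hu.isRadiallySymmetric hN2 hf hs⟩
  rintro ⟨u, hu, hbot, htop, hmin⟩
  obtain ⟨v, hv, hrad, hle⟩ := exists_radiallySymmetric_energy_le hN0 hf hmono hu hbot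
  have heq : energy R f v = energy R f u := le_antisymm hle (hmin v hv)
  exact ⟨v, ⟨hv, heq ▸ hbot, heq ▸ htop, fun w hw => heq ▸ hmin w hw⟩, hrad⟩
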